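/- **Setting.** A dyadic interval is $[2^{-k}\ell,2^{-k}(\ell+1))$ with $k,\ell\in\mathbb Z$; an $N$-dimensional dyadic cube is a product of $N$ dyadic intervals of equal length, and $\mathcal C$ denotes the set of dyadic squares $Q=I\times J$ in $\mathbb R^2$. For a dyadic interval $I$ put $\mathbf h_I=\mathbf 1_{I_{\rm left}}-\mathbf 1_{I_{\rm right}}$. Let $m,n$ be positive integers and $E\subseteq\{1,\dots,m\}\times\{1,\dots,n\}$ the edge set of a bipartite graph $G$ on the vertices $x_1,\dots,x_m$ and $y_1,\dots,y_n$ with no isolated vertices. For $(i,j)\in E$ let $M_{i,j}$ be the larger of the number of $x$-vertices and the number of $y$-vertices in the connected component of $G$ that contains the edge $(i,j)$, and put $d_{i,j}=M_{i,j}$ if this component is a complete bipartite graph or $M_{i,j}\le 2$, and $d_{i,j}=M_{i,j}+1$ otherwise. Let $K:\mathbb R^{m+n}\to\mathbb C$ be a perfect dyadic Calderón–Zygmund kernel: $K$ is locally integrable, bounded and compactly supported, it satisfies, with some finite constant $A$, $$|K(x_1,\dots,x_m,y_1,\dots,y_n)|\le A\Big(\sum_{i_1<i_2}|x_{i_1}-x_{i_2}|+\sum_{j_1<j_2}|y_{j_1}-y_{j_2}|\Big)^{2-m-n}$$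 off the diagonal $D=\{(x,\dots,x,y,\dots,y):x,y\in\mathbb R\}$, and it is constant on every $(m+n)$-dimensional dyadic cube disjoint from $D$. For $(u,v)\in E$ put $$T_{u,v}\big((F_{i,j})_{(i,j)\in E\setminus\{(u,v)\}}\big)(x_u,y_v)=\int_{\mathbb R^{m+n-2}}K\prod_{(i,j)\in E\setminus\{(u,v)\}}F_{i,j}(x_i,y_j)\prod_{i\ne u}dx_i\prod_{j\ne v}dy_j ,$$ and let $\|F\|_{\mathrm{BMO}}=\sup_{Q\in\mathcal C}\big(\frac1{|Q|}\int_Q|F-\frac1{|Q|}\int_QF|^2\big)^{1/2}$. Let $S\subseteq\{1,\dots,m\}$ and $T\subseteq\{1,\dots,n\}$ be not both empty. Put $\mathbf a^{(i)}=\mathbf h$ for $i\in S$, $\mathbf b^{(j)}=\mathbf h$ for $j\in T$, and let all the remaining $\mathbf a^{(i)},\mathbf b^{(j)}$ be $\mathbf 1$. Define, for $Q=I\times J\in\mathcal C$, $$\lambda_Q=\frac1{|Q|}\int_{\mathbb R^{m+n}}K\prod_{i}\mathbf a^{(i)}_I(x_i)\prod_j\mathbf b^{(j)}_J(y_j)\,dx\,dy,$$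 $$\mathcal A_Q=\frac{1}{|I|^{m}|J|^{n}}\int_{\mathbb R^{m+n}}\prod_{(i,j)\in E}F_{i,j}(x_i,y_j)\prod_{i}\mathbf a^{(i)}_I(x_i)\prod_j\mathbf b^{(j)}_J(y_j)\,dx\,dy .$$ Assume that the resulting entangled dyadic paraproduct $\Theta=\sum_{Q\in\mathcal C}\lambda_Q|Q|\mathcal A_Q$ is non-cancellative, i.e. some edge of $G$ is incident to all the vertices $x_i$ ($i\in S$) and $y_j$ ($j\in T$). (Equivalently, $|S|+|T|=1$, or $S=\{i\}$, $T=\{j\}$ with $(i,j)\in E$.) Put $$\|\lambda\|_{\mathrm{bmo}}=\sup_{Q_0\in\mathcal C}\Big(\frac1{|Q_0|}\sum_{Q\in\mathcal C,\,Q\subseteq Q_0}|Q||\lambda_Q|^2\Big)^{1/2}.$$ A finite convex tree $\mathcal T$ is a finite set of dyadic squares that is convex with respect to inclusion and contains a largest square $Q_{\mathcal T}$; $\mathcal L(\mathcal T)$ is the set of dyadic squares that are not in $\mathcal T$ but whose dyadic parent is in $\mathcal T$. Put $\Theta_{\mathcal T}=\sum_{Q\in\mathcal T}|\lambda_Q||Q||\mathcal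 A_Q|$, and let $[F]_Q$ denote the average of $F$ over $Q$. **Proposition.** Let $m,n,E,S,T$ be as above. (a) For every $B$ there is a constant $C$, depending only on $B$ and $m,n,E,S,T$, such that for every perfect dyadic Calderón–Zygmund kernel $K$: if $\|T_{u,v}(\mathbf 1_{\mathbb R^2},\dots,\mathbf 1_{\mathbb R^2})\|_{\mathrm{BMO}}\le B$ for each $(u,v)\in E$, then $\|\lambda\|_{\mathrm{bmo}}\le C$. (b) There is a constant $C$, depending only on $m,n,E,S,T$, such that for every perfect dyadic Calderón–Zygmund kernel $K$, every finite convex tree $\mathcal T$, and all nonnegative, measurable, bounded, compactly supported functions $F_{i,j}$ on $\mathbb R^2$, $(i,j)\in E$, $$\Theta_{\mathcal T}\big((F_{i,j})_{(i,j)\in E}\big)\le C\,\|\lambda\|_{\mathrm{bmo}}\,|Q_{\mathcal T}|\prod_{(i,j)\in E}\ \max_{Q\in\mathcal T\cup\mathcal L(\mathcal T)}\big[F_{i,j}^{d_{i,j}}\big]_Q^{1/d_{i,j}} .$$ -/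

import Mathlib

open MeasureTheory
open scoped ENNReal

namespace EntangledParaproduct

noncomputable section

/-! ### Dyadic intervals, squares and trees -/

/-- The dyadic interval `[2⁻ᵏ ℓ, 2⁻ᵏ (ℓ + 1))`. -/
def dyadicInterval (k l : ℤ) : Set ℝ :=
  Set.Ico ((2 : ℝ) ^ (-k) * l) ((2 : ℝ) ^ (-k) * (l + 1))

/-- The `L^∞`-normalized Haar function `1_{left half} - 1_{right half}` of
`dyadicInterval k l`. -/
def haar (k l : ℤ) (t : ℝ) : ℝ :=
  (dyadicInterval (k + 1) (2 * l)).indicator 1 t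
    - (dyadicInterval (k + 1) (2 * l + 1)).indicator 1 t

/-- The characteristic function of `dyadicInterval k l`. -/
def charFn (k l : ℤ) (t : ℝ) : ℝ := (dyadicInterval k l).indicator 1 t

/-- Dyadic squares `I × J` with `I = dyadicInterval k a`, `J = dyadicInterval k b`. Different
triples `(k, a, b)` give different subsets of the plane. -/
@[ext]
structure DyadicSquare where
  k : ℤ
  a : ℤ
  b : ℤ

namespace DyadicSquare

/-- The underlying subset of the plane. -/
def toSet (Q : DyadicSquare) : Set (ℝ × ℝ) :=
  dyadicInterval Q.k Q.a ×ˢ dyadicInterval Q.k Q.b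

/-- The side length `|I| = |J|`. -/
def side (Q : DyadicSquare) : ℝ := (2 : ℝ) ^ (-Q.k)

/-- The area `|Q| = |I| |J|`. -/
def area (Q : DyadicSquare) : ℝ := Q.side * Q.side

/-- The unique dyadic square of twice the side length that contains `Q`
(the division of integers rounds down). -/
def parent (Q : DyadicSquare) : DyadicSquare := ⟨Q.k - 1, Q.a / 2, Q.b / 2⟩

end DyadicSquare

/-- A finite collection of dyadic squares that is convex with respect to inclusion and contains
a largest square, the tree-top. -/
structure FiniteConvexTree where
  squares : Finset DyadicSquare
  top : DyadicSquare
  top_mem : top ∈ squares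
  subset_top : ∀ Q ∈ squares, Q.toSet ⊆ top.toSet
  convex : ∀ Q₁ ∈ squares, ∀ Q₃ ∈ squares, ∀ Q₂ : DyadicSquare,
    Q₁.toSet ⊆ Q₂.toSet → Q₂.toSet ⊆ Q₃.toSet → Q₂ ∈ squares

/-- The leaves of a tree: squares outside the tree whose parent is in the tree. -/
def FiniteConvexTree.leaves (𝒯 : FiniteConvexTree) : Set DyadicSquare :=
  {Q | Q ∉ 𝒯.squares ∧ Q.parent ∈ 𝒯.squares}

/-! ### Perfect dyadic Calderón–Zygmund kernels -/

/-- The diagonal `{(x, …, x, y, …, y)}` of `ℝᵐ × ℝⁿ`. -/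
def diagonal (m n : ℕ) : Set ((Fin m → ℝ) × (Fin n → ℝ)) :=
  {p | ∃ x y : ℝ, p = (fun _ => x, fun _ => y)}

/-- The `(m+n)`-dimensional dyadic cube `I₁ × ⋯ × Iₘ × J₁ × ⋯ × Jₙ`. -/
def dyadicCube {m n : ℕ} (k : ℤ) (a : Fin m → ℤ) (b : Fin n → ℤ) :
    Set ((Fin m → ℝ) × (Fin n → ℝ)) :=
  {p | (∀ i, p.1 i ∈ dyadicInterval k (a i)) ∧ ∀ j, p.2 j ∈ dyadicInterval k (b j)}

/-- `∑_{i₁ < i₂} |x_{i₁} - x_{i₂}| + ∑_{j₁ < j₂} |y_{j₁} - y_{j₂}|`. -/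
def offDiagonal {m n : ℕ} (p : (Fin m → ℝ) × (Fin n → ℝ)) : ℝ :=
  (∑ i₁, ∑ i₂ ∈ Finset.Ioi i₁, |p.1 i₁ - p.1 i₂|)
    + ∑ j₁, ∑ j₂ ∈ Finset.Ioi j₁, |p.2 j₁ - p.2 j₂|

/-- Perfect dyadic Calderón–Zygmund kernels, including the qualitative assumption that they are
bounded and compactly supported. -/
structure IsPerfectDyadicCZKernel {m n : ℕ} (K : (Fin m → ℝ) × (Fin n → ℝ) → ℂ) : Prop where
  locallyIntegrable : LocallyIntegrable K
  size_bound : ∃ A : ℝ, ∀ p, p ∉ diagonal m n →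
    ‖K p‖ ≤ A * offDiagonal p ^ (2 - (m : ℤ) - (n : ℤ))
  perfect : ∀ (k : ℤ) (a : Fin m → ℤ) (b : Fin n → ℤ),
    Disjoint (dyadicCube k a b) (diagonal m n) →
      ∀ p ∈ dyadicCube k a b, ∀ q ∈ dyadicCube k a b, K p = K q
  bounded : ∃ M : ℝ, ∀ p, ‖K p‖ ≤ M
  hasCompactSupport : HasCompactSupport K

/-! ### The bipartite graph -/

/-- Every vertex `x_i` and every vertex `y_j` is incident to some edge. -/
def NoIsolatedVertices {m n : ℕ} (E : Finset (Fin m × Fin n)) : Prop :=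
  (∀ i, ∃ j, (i, j) ∈ E) ∧ ∀ j, ∃ i, (i, j) ∈ E

/-- The simple bipartite graph on `{x_1, …, x_m} ⊔ {y_1, …, y_n}` with edge set `E`. -/
def bipartiteGraph {m n : ℕ} (E : Finset (Fin m × Fin n)) : SimpleGraph (Fin m ⊕ Fin n) :=
  SimpleGraph.fromRel fun v w => ∃ e ∈ E, v = Sum.inl e.1 ∧ w = Sum.inr e.2

/-- Indices of the vertices `x_i` in the connected component of the edge `e`. -/
def componentX {m n : ℕ} (E : Finset (Fin m × Fin n)) (e : Fin m × Fin n) : Set (Fin m) :=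
  {i | (bipartiteGraph E).Reachable (Sum.inl e.1) (Sum.inl i)}

/-- Indices of the vertices `y_j` in the connected component of the edge `e`. -/
def componentY {m n : ℕ} (E : Finset (Fin m × Fin n)) (e : Fin m × Fin n) : Set (Fin n) :=
  {j | (bipartiteGraph E).Reachable (Sum.inl e.1) (Sum.inr j)}

open Classical in
/-- The thresholds `d_{i,j}`: the size `max (|X|, |Y|)` of the component of the edge if this
component is complete bipartite or the size is at most two, and this size plus one otherwise. -/
def threshold {m n : ℕ} (E : Finset (Fin m × Fin n)) (e : Fin m × Fin n) : ℕ :=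
  if (∀ i ∈ componentX E e, ∀ j ∈ componentY E e, (i, j) ∈ E) ∨
      max (componentX E e).ncard (componentY E e).ncard ≤ 2 then
    max (componentX E e).ncard (componentY E e).ncard
  else
    max (componentX E e).ncard (componentY E e).ncard + 1

/-- Some edge of the graph is incident to all vertices `x_i`, `i ∈ S`, and `y_j`, `j ∈ T`. -/
def IsNonCancellative {m n : ℕ} (E : Finset (Fin m × Fin n))
    (S : Finset (Fin m)) (T : Finset (Fin n)) : Prop :=
  ∃ e ∈ E, (∀ i ∈ S, i = e.1) ∧ ∀ j ∈ T, j = e.2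

/-! ### The operators `T_{u,v}` and the dyadic BMO seminorm -/

/-- The point with `u`-th coordinate `t` and the other coordinates given by `x`. -/
def glue {m : ℕ} (u : Fin m) (t : ℝ) (x : {i : Fin m // i ≠ u} → ℝ) : Fin m → ℝ :=
  fun i => if h : i = u then t else x ⟨i, h⟩

/-- The operator `T_{u,v}`, with `(u, v) = e`, applied to the functions `F_{i,j}`,
`(i, j) ∈ E \ {(u, v)}`, as a function of `(x_u, y_v)`. -/
def adjointOp {m n : ℕ} (E : Finset (Fin m × Fin n)) (K : (Fin m → ℝ) × (Fin n → ℝ) → ℂ)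
    (e : Fin m × Fin n) (F : Fin m × Fin n → ℝ × ℝ → ℂ) (z : ℝ × ℝ) : ℂ :=
  ∫ w : ({i : Fin m // i ≠ e.1} → ℝ) × ({j : Fin n // j ≠ e.2} → ℝ),
    K (glue e.1 z.1 w.1, glue e.2 z.2 w.2) *
      ∏ f ∈ E.erase e, F f (glue e.1 z.1 w.1 f.1, glue e.2 z.2 w.2 f.2)

/-- The dyadic BMO seminorm of a locally integrable function on the plane. -/
def dyadicBMO (F : ℝ × ℝ → ℂ) : ℝ≥0∞ :=
  ⨆ Q : DyadicSquare,
    ((ENNReal.ofReal Q.area)⁻¹ *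
      ∫⁻ z in Q.toSet, ‖F z - (Q.area : ℂ)⁻¹ * ∫ w in Q.toSet, F w‖ₑ ^ 2) ^ (1 / 2 : ℝ)

/-! ### Entangled dyadic paraproducts -/

/-- `∏ᵢ a⁽ⁱ⁾_I(xᵢ) ∏ⱼ b⁽ʲ⁾_J(yⱼ)` on `Q = I × J`, where `a⁽ⁱ⁾ = h` for `i ∈ S`, `b⁽ʲ⁾ = h` for
`j ∈ T`, and the remaining functions are characteristic functions. -/
def tensor {m n : ℕ} (S : Finset (Fin m)) (T : Finset (Fin n)) (Q : DyadicSquare)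
    (p : (Fin m → ℝ) × (Fin n → ℝ)) : ℝ :=
  (∏ i, if i ∈ S then haar Q.k Q.a (p.1 i) else charFn Q.k Q.a (p.1 i)) *
    ∏ j, if j ∈ T then haar Q.k Q.b (p.2 j) else charFn Q.k Q.b (p.2 j)

/-- The coefficients `λ_Q = |Q|⁻¹ ⟨K, a⁽¹⁾_I ⊗ ⋯ ⊗ a⁽ᵐ⁾_I ⊗ b⁽¹⁾_J ⊗ ⋯ ⊗ b⁽ⁿ⁾_J⟩` of the
paraproduct of type `(S, T)` of a kernel `K`. -/
def coefficient {m n : ℕ} (K : (Fin m → ℝ) × (Fin n → ℝ) → ℂ)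
    (S : Finset (Fin m)) (T : Finset (Fin n)) (Q : DyadicSquare) : ℂ :=
  (Q.area : ℂ)⁻¹ * ∫ p, K p * (tensor S T Q p : ℂ)

/-- The dyadic `bmo` norm of a family of coefficients indexed by dyadic squares. -/
def bmoNorm (lam : DyadicSquare → ℂ) : ℝ≥0∞ :=
  ⨆ Q₀ : DyadicSquare,
    ((ENNReal.ofReal Q₀.area)⁻¹ *
      ∑' Q : {Q : DyadicSquare // Q.toSet ⊆ Q₀.toSet},
        ENNReal.ofReal Q.1.area * ‖lam Q.1‖ₑ ^ 2) ^ (1 / 2 : ℝ)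

/-- The paraproduct term `𝒜_Q`: the average over `x_i ∈ I`, `y_j ∈ J` of the product
`∏_{(i,j) ∈ E} F_{i,j}(x_i, y_j)`, weighted by Haar functions in the variables with `i ∈ S`,
`j ∈ T`. -/
def paraproductTerm {m n : ℕ} (E : Finset (Fin m × Fin n))
    (S : Finset (Fin m)) (T : Finset (Fin n)) (F : Fin m × Fin n → ℝ × ℝ → ℝ)
    (Q : DyadicSquare) : ℝ :=
  (Q.side ^ (m + n))⁻¹ *
    ∫ p : (Fin m → ℝ) × (Fin n → ℝ), (∏ e ∈ E, F e (p.1 e.1, p.2 e.2)) * tensor S T Q p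

/-- The localized form `Θ_𝒯 = ∑_{Q ∈ 𝒯} |λ_Q| |Q| |𝒜_Q|`. -/
def localizedForm {m n : ℕ} (E : Finset (Fin m × Fin n))
    (S : Finset (Fin m)) (T : Finset (Fin n)) (lam : DyadicSquare → ℂ)
    (𝒯 : FiniteConvexTree) (F : Fin m × Fin n → ℝ × ℝ → ℝ) : ℝ :=
  ∑ Q ∈ 𝒯.squares, ‖lam Q‖ * Q.area * |paraproductTerm E S T F Q|

/-- `[F^d]_Q^{1/d}` for a nonnegative function `F`. -/
def powerMean (d : ℕ) (F : ℝ × ℝ → ℝ) (Q : DyadicSquare) : ℝ≥0∞ :=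
  ((ENNReal.ofReal Q.area)⁻¹ * ∫⁻ z in Q.toSet, ENNReal.ofReal (F z ^ d)) ^ (1 / (d : ℝ))

/-- `max_{Q ∈ 𝒯 ∪ 𝓛(𝒯)} [F^d]_Q^{1/d}`. -/
def maxPowerMean (d : ℕ) (F : ℝ × ℝ → ℝ) (𝒯 : FiniteConvexTree) : ℝ≥0∞ :=
  ⨆ Q ∈ {Q : DyadicSquare | Q ∈ 𝒯.squares ∨ Q ∈ 𝒯.leaves}, powerMean d F Q

/-- The admissible functions: nonnegative, measurable, bounded and compactly supported. -/
structure IsAdmissible (F : ℝ × ℝ → ℝ) : Prop where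
  nonneg : ∀ z, 0 ≤ F z
  measurable : Measurable F
  bounded : ∃ M : ℝ, ∀ z, F z ≤ M
  hasCompactSupport : HasCompactSupport F

end

end EntangledParaproduct

open EntangledParaproduct

/-!
Part (a) is Bessel's inequality. Let `(u, v)` be an edge incident to all variables that carry a
Haar function. If one of the other variables leaves the side of `Q` it belongs to, a perfect kernel
is constant in `(x_u, y_v)` on `Q`; hence `|Q| λ_Q` is the pairing of `T_{u,v}(1, …, 1)` with a
Haar-type function `h_Q` (`IsPerfectDyadicCZKernel.area_mul_coefficient`). The functions `h_Q` are
orthogonal, have mean zero, and have squared norm `|Q|`, so that the `bmo` norm of `λ` is at most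
the `BMO` seminorm of `T_{u,v}(1, …, 1)`.

For part (b), the Cauchy–Schwarz inequality extracts the `bmo` norm and leaves the square function
estimate `∑_{Q ∈ 𝒯} |Q| 𝒜_Q² ≤ C |Q_𝒯|` for functions whose relevant power means are at most one.
A bipartite Hölder inequality (`lintegral_bipartite_le`) bounds the factors of `𝒜_Q` that belong to
the connected components without Haar functions by one. For the component of `(u, v)`, squares are
dominated by the increments of a Bellman function `Φ`: it suffices that `Φ` is bounded on the
squares in question and `𝒜_Q² + Φ(Q)` is at most the average of `Φ` over the four children of `Q`,
as this telescopes over the tree (`FiniteConvexTree.sum_area_mul_le`).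

If the component is a single edge, `Φ` is the square of the average of the function. Otherwise let
`p ≥ 2` be the larger number of vertices of the component on a side, and say that the Haar function
is in the variable `x_{i₀}`. With `u_i(y)` the average of `∏ⱼ F i j (x, y_j)` in `x` and `Δ_i(y)`
half the difference of its averages over the two halves of the `x`-interval, `|𝒜_Q|` is at most the
average over `y` of `|Δ_{i₀}| U^{p-1}`, where `U` is the sum of all `u_i` and of the dummy row `1`.
Its square is at most the average of `Δ_{i₀}² U^{p-2}` times the average of `U^p`, where only `p`
rows occur. It remains to realize `Δ_{i₀}² U^{p-2}` as an increment. The average over `y` of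
`(∑ᵢ vᵢ u_i)^p`, with nonnegative weights `v`, increases at least by `(∑ᵢ vᵢ Δ_i)² (∑ᵢ vᵢ u_i)^{p-2}`
when the `x`-interval is halved; two choices of `v` isolate `Δ_{i₀}`. In order that halving the
`y`-interval does not decrease this average, one also sums over all ways to label the `y`-variables
by columns. The result (`symForm`) is the form of complete bipartite shape that carries the *same*
function of `((x, i), (y, j))` on each edge. It is symmetric in the two groups of variables, hence
convex in each of them. This works with `p` in place of the thresholds, which are at least `p`.
-/

namespace EntangledParaproduct

noncomputable section

/-! ### Dyadic intervals and normalized Lebesgue measure -/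

theorem two_zpow_pos (k : ℤ) : (0 : ℝ) < 2 ^ k := zpow_pos two_pos k

theorem mem_dyadicInterval {k l : ℤ} {t : ℝ} :
    t ∈ dyadicInterval k l ↔ ⌊(2 : ℝ) ^ k * t⌋ = l := by
  have h : (2 : ℝ) ^ k * 2 ^ (-k) = 1 := by
    rw [← zpow_add₀ two_ne_zero, add_neg_cancel, zpow_zero]
  have h2 := two_zpow_pos k
  rw [dyadicInterval, Set.mem_Ico, Int.floor_eq_iff, ← mul_le_mul_iff_right₀ h2,
    ← mul_lt_mul_iff_right₀ h2, ← mul_assoc, ← mul_assoc, h, one_mul, one_mul]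

theorem measurableSet_dyadicInterval (k l : ℤ) : MeasurableSet (dyadicInterval k l) :=
  measurableSet_Ico

theorem volume_dyadicInterval (k l : ℤ) :
    volume (dyadicInterval k l) = ENNReal.ofReal (2 ^ (-k)) := by
  rw [dyadicInterval, Real.volume_Ico]
  congr 1
  ring

theorem floor_two_zpow_succ (k : ℤ) (t : ℝ) :
    ⌊(2 : ℝ) ^ (k + 1) * t⌋ / 2 = ⌊(2 : ℝ) ^ k * t⌋ := by
  have h : (2 : ℝ) ^ k * t = (2 : ℝ) ^ (k + 1) * t / (2 : ℕ) := by
    rw [zpow_add_one₀ two_ne_zero]; push_cast; ring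
  rw [h, Int.floor_div_natCast]
  rfl

theorem dyadicInterval_succ_subset (k l : ℤ) :
    dyadicInterval (k + 1) l ⊆ dyadicInterval k (l / 2) := by
  intro t ht
  rw [mem_dyadicInterval] at *
  rw [← ht, floor_two_zpow_succ]

theorem dyadicInterval_eq_union (k l : ℤ) :
    dyadicInterval k l = dyadicInterval (k + 1) (2 * l) ∪ dyadicInterval (k + 1) (2 * l + 1) := by
  ext t
  simp only [Set.mem_union, mem_dyadicInterval, ← floor_two_zpow_succ k t]
  omega

theorem dyadicInterval_disjoint {k l l' : ℤ} (h : l ≠ l') :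
    Disjoint (dyadicInterval k l) (dyadicInterval k l') := by
  rw [Set.disjoint_left]
  intro t ht ht'
  rw [mem_dyadicInterval] at *
  exact h (ht.symm.trans ht')

theorem dyadicInterval_nonempty (k l : ℤ) : (dyadicInterval k l).Nonempty := by
  refine ⟨2 ^ (-k) * l, ?_⟩
  rw [dyadicInterval, Set.left_mem_Ico]
  have := two_zpow_pos (-k)
  nlinarith

/-- Lebesgue measure on a dyadic interval, normalized to a probability measure. -/
def avgMeasure (k l : ℤ) : Measure ℝ :=
  ENNReal.ofReal (2 ^ k) • volume.restrict (dyadicInterval k l)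

theorem ofReal_two_zpow_mul (k : ℤ) :
    ENNReal.ofReal (2 ^ k) * ENNReal.ofReal (2 ^ (-k)) = 1 := by
  rw [← ENNReal.ofReal_mul (two_zpow_pos k).le, ← zpow_add₀ two_ne_zero, add_neg_cancel,
    zpow_zero, ENNReal.ofReal_one]

instance (k l : ℤ) : IsProbabilityMeasure (avgMeasure k l) := by
  constructor
  rw [avgMeasure, Measure.smul_apply, Measure.restrict_apply_univ, volume_dyadicInterval,
    smul_eq_mul, ofReal_two_zpow_mul]

theorem avgMeasure_eq_half (k l : ℤ) :
    avgMeasure k l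
      = (2⁻¹ : ℝ≥0∞) • (avgMeasure (k + 1) (2 * l) + avgMeasure (k + 1) (2 * l + 1)) := by
  have h : ENNReal.ofReal (2 ^ k) = 2⁻¹ * ENNReal.ofReal (2 ^ (k + 1)) := by
    rw [zpow_add_one₀ two_ne_zero, mul_comm, ENNReal.ofReal_mul (two_zpow_pos k).le, mul_assoc]
    simp [ENNReal.mul_inv_cancel]
  rw [avgMeasure, avgMeasure, avgMeasure, ← smul_add, smul_smul, ← h,
    ← Measure.restrict_union (dyadicInterval_disjoint (by omega))
      (measurableSet_dyadicInterval _ _), ← dyadicInterval_eq_union]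

theorem integral_half {α : Type*} [MeasurableSpace α] {μ μ₀ μ₁ : Measure α}
    (hμ : μ = (2⁻¹ : ℝ≥0∞) • (μ₀ + μ₁)) {f : α → ℝ} (h₀ : Integrable f μ₀)
    (h₁ : Integrable f μ₁) :
    ∫ x, f x ∂μ = ((∫ x, f x ∂μ₀) + ∫ x, f x ∂μ₁) / 2 := by
  rw [hμ, integral_smul_measure, integral_add_measure h₀ h₁]
  simp
  ring

theorem avgMeasure_ae_mem (k l : ℤ) : ∀ᵐ t ∂avgMeasure k l, t ∈ dyadicInterval k l :=
  Measure.ae_smul_measure (ae_restrict_mem (measurableSet_dyadicInterval k l)) _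

theorem integral_charFn_mul (k l : ℤ) (f : ℝ → ℝ) :
    ∫ t, charFn k l t * f t ∂avgMeasure k l = ∫ t, f t ∂avgMeasure k l := by
  refine integral_congr_ae ?_
  filter_upwards [avgMeasure_ae_mem k l] with t ht
  simp [charFn, ht]

theorem measurable_charFn (k l : ℤ) : Measurable (charFn k l) :=
  measurable_one.indicator (measurableSet_dyadicInterval k l)

theorem measurable_haar (k l : ℤ) : Measurable (haar k l) :=
  (measurable_charFn (k + 1) (2 * l)).sub (measurable_charFn (k + 1) (2 * l + 1))

theorem haar_of_left {k l : ℤ} {t : ℝ} (ht : t ∈ dyadicInterval (k + 1) (2 * l)) :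
    haar k l t = 1 := by
  have := Set.disjoint_left.1 (dyadicInterval_disjoint (k := k + 1)
    (show 2 * l ≠ 2 * l + 1 by omega)) ht
  simp [haar, ht, this]

theorem haar_of_right {k l : ℤ} {t : ℝ} (ht : t ∈ dyadicInterval (k + 1) (2 * l + 1)) :
    haar k l t = -1 := by
  have := Set.disjoint_right.1 (dyadicInterval_disjoint (k := k + 1)
    (show 2 * l ≠ 2 * l + 1 by omega)) ht
  simp [haar, ht, this]

theorem haar_of_notMem {k l : ℤ} {t : ℝ} (ht : t ∉ dyadicInterval k l) : haar k l t = 0 := by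
  rw [dyadicInterval_eq_union, Set.mem_union, not_or] at ht
  simp [haar, ht.1, ht.2]

theorem charFn_of_mem {k l : ℤ} {t : ℝ} (ht : t ∈ dyadicInterval k l) : charFn k l t = 1 := by
  simp [charFn, ht]

theorem charFn_of_notMem {k l : ℤ} {t : ℝ} (ht : t ∉ dyadicInterval k l) :
    charFn k l t = 0 := by
  simp [charFn, ht]

theorem haar_mul_self (k l : ℤ) (t : ℝ) : haar k l t * haar k l t = charFn k l t := by
  by_cases ht : t ∈ dyadicInterval k l
  · rw [charFn_of_mem ht]
    rw [dyadicInterval_eq_union] at ht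
    rcases ht with h | h
    · simp [haar_of_left h]
    · simp [haar_of_right h]
  · simp [haar_of_notMem ht, charFn_of_notMem ht]

theorem abs_haar_le_one (k l : ℤ) (t : ℝ) : |haar k l t| ≤ 1 := by
  by_cases ht : t ∈ dyadicInterval k l
  · rw [dyadicInterval_eq_union] at ht
    rcases ht with h | h
    · simp [haar_of_left h]
    · simp [haar_of_right h]
  · simp [haar_of_notMem ht]

theorem abs_charFn_le_one (k l : ℤ) (t : ℝ) : |charFn k l t| ≤ 1 := by
  by_cases ht : t ∈ dyadicInterval k l
  · simp [charFn_of_mem ht]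
  · simp [charFn_of_notMem ht]

theorem integral_haar_mul (k l : ℤ) {f : ℝ → ℝ} (hf : Measurable f) (hb : ∃ M, ∀ t, |f t| ≤ M) :
    ∫ t, haar k l t * f t ∂avgMeasure k l
      = ((∫ t, f t ∂avgMeasure (k + 1) (2 * l))
          - ∫ t, f t ∂avgMeasure (k + 1) (2 * l + 1)) / 2 := by
  obtain ⟨M, hM⟩ := hb
  have hi : ∀ j c, Integrable (fun t => haar k l t * f t) (avgMeasure j c) := fun j c =>
    Integrable.of_bound ((measurable_haar k l).mul hf).aestronglyMeasurable M
      (.of_forall fun t => by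
        rw [Real.norm_eq_abs, abs_mul]
        nlinarith [abs_haar_le_one k l t, abs_nonneg (f t), hM t, abs_nonneg (haar k l t)])
  rw [integral_half (avgMeasure_eq_half k l) (hi _ _) (hi _ _)]
  congr 1
  rw [sub_eq_add_neg, ← integral_neg]
  congr 1
  · refine integral_congr_ae ?_
    filter_upwards [avgMeasure_ae_mem _ _] with t ht
    simp [haar_of_left ht]
  · refine integral_congr_ae ?_
    filter_upwards [avgMeasure_ae_mem _ _] with t ht
    simp [haar_of_right ht]

/-! ### Dyadic squares and telescoping over trees -/

theorem floor_two_zpow_add (k : ℤ) (d : ℕ) (t : ℝ) :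
    ⌊(2 : ℝ) ^ (k + d) * t⌋ / 2 ^ d = ⌊(2 : ℝ) ^ k * t⌋ := by
  have h : (2 : ℝ) ^ k * t = (2 : ℝ) ^ (k + d) * t / ((2 ^ d : ℕ) : ℝ) := by
    rw [zpow_add₀ two_ne_zero, zpow_natCast]; push_cast; field_simp
  rw [h, Int.floor_div_natCast]
  push_cast
  rfl

theorem dyadicInterval_add_subset (k l : ℤ) (d : ℕ) :
    dyadicInterval (k + d) l ⊆ dyadicInterval k (l / 2 ^ d) := by
  intro t ht
  rw [mem_dyadicInterval] at *
  rw [← ht, floor_two_zpow_add]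

theorem dyadicInterval_subset_of_mem {k k' l l' : ℤ} (hk : k' ≤ k) {t : ℝ}
    (ht : t ∈ dyadicInterval k l) (ht' : t ∈ dyadicInterval k' l') :
    dyadicInterval k l ⊆ dyadicInterval k' l' := by
  obtain ⟨d, rfl⟩ := Int.le.dest hk
  have h1 := dyadicInterval_add_subset k' l d
  have h2 := h1 ht
  rw [mem_dyadicInterval] at h2 ht'
  rwa [← h2, ht'] at h1

theorem le_of_dyadicInterval_subset {k k' l l' : ℤ}
    (h : dyadicInterval k l ⊆ dyadicInterval k' l') : k' ≤ k := by
  have h1 := measure_mono (μ := volume) h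
  rw [volume_dyadicInterval, volume_dyadicInterval,
    ENNReal.ofReal_le_ofReal_iff (two_zpow_pos _).le, zpow_le_zpow_iff_right₀ one_lt_two] at h1
  omega

namespace DyadicSquare

theorem side_pos (Q : DyadicSquare) : 0 < Q.side := two_zpow_pos _

theorem area_pos (Q : DyadicSquare) : 0 < Q.area := mul_pos Q.side_pos Q.side_pos

theorem toSet_nonempty (Q : DyadicSquare) : Q.toSet.Nonempty :=
  (dyadicInterval_nonempty _ _).prod (dyadicInterval_nonempty _ _)

theorem subset_of_mem {Q Q' : DyadicSquare} (hk : Q'.k ≤ Q.k) {z : ℝ × ℝ} (hz : z ∈ Q.toSet)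
    (hz' : z ∈ Q'.toSet) : Q.toSet ⊆ Q'.toSet :=
  Set.prod_mono (dyadicInterval_subset_of_mem hk hz.1 hz'.1)
    (dyadicInterval_subset_of_mem hk hz.2 hz'.2)

theorem eq_of_mem {Q Q' : DyadicSquare} (hk : Q'.k = Q.k) {z : ℝ × ℝ} (hz : z ∈ Q.toSet)
    (hz' : z ∈ Q'.toSet) : Q = Q' := by
  have h1 := mem_dyadicInterval.1 hz.1
  have h2 := mem_dyadicInterval.1 hz.2
  have h3 := mem_dyadicInterval.1 hz'.1
  have h4 := mem_dyadicInterval.1 hz'.2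
  rw [hk] at h3 h4
  exact DyadicSquare.ext hk.symm (h1.symm.trans h3) (h2.symm.trans h4)

theorem subset_parent (Q : DyadicSquare) : Q.toSet ⊆ Q.parent.toSet := by
  have h : ∀ l, dyadicInterval Q.k l ⊆ dyadicInterval (Q.k - 1) (l / 2) := fun l => by
    simpa using dyadicInterval_succ_subset (Q.k - 1) l
  exact Set.prod_mono (h _) (h _)

theorem k_le_of_subset {Q Q' : DyadicSquare} (h : Q.toSet ⊆ Q'.toSet) : Q'.k ≤ Q.k := by
  obtain ⟨z, hz⟩ := Q.toSet_nonempty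
  exact le_of_dyadicInterval_subset fun t ht => (h (Set.mk_mem_prod ht hz.2)).1

/-- A dyadic square strictly inside `Q'` has its parent inside `Q'`. -/
theorem parent_subset {Q Q' : DyadicSquare} (h : Q.toSet ⊆ Q'.toSet) (hne : Q ≠ Q') :
    Q.parent.toSet ⊆ Q'.toSet := by
  obtain ⟨z, hz⟩ := Q.toSet_nonempty
  have h1 : Q'.k ≠ Q.k := fun hk => hne (eq_of_mem hk hz (h hz))
  have h2 := k_le_of_subset h
  refine subset_of_mem (z := z) ?_ (Q.subset_parent hz) (h hz)
  change Q'.k ≤ Q.k - 1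
  omega

open Classical in
/-- The four dyadic squares whose parent is `Q`. -/
def children (Q : DyadicSquare) : Finset DyadicSquare :=
  {⟨Q.k + 1, 2 * Q.a, 2 * Q.b⟩, ⟨Q.k + 1, 2 * Q.a, 2 * Q.b + 1⟩,
    ⟨Q.k + 1, 2 * Q.a + 1, 2 * Q.b⟩, ⟨Q.k + 1, 2 * Q.a + 1, 2 * Q.b + 1⟩}

theorem mem_children {Q Q' : DyadicSquare} : Q' ∈ Q.children ↔ Q'.parent = Q := by
  simp only [children, Finset.mem_insert, Finset.mem_singleton, DyadicSquare.ext_iff, parent]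
  omega

open Classical in
theorem sum_children (Q : DyadicSquare) (f : DyadicSquare → ℝ) :
    ∑ Q' ∈ Q.children, f Q' =
      f ⟨Q.k + 1, 2 * Q.a, 2 * Q.b⟩ + f ⟨Q.k + 1, 2 * Q.a, 2 * Q.b + 1⟩
        + f ⟨Q.k + 1, 2 * Q.a + 1, 2 * Q.b⟩ + f ⟨Q.k + 1, 2 * Q.a + 1, 2 * Q.b + 1⟩ := by
  unfold children
  rw [Finset.sum_insert, Finset.sum_insert, Finset.sum_insert, Finset.sum_singleton]
  · ring
  all_goals simp [DyadicSquare.ext_iff]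

theorem area_child {Q Q' : DyadicSquare} (h : Q' ∈ Q.children) : Q'.area = Q.area / 4 := by
  rw [mem_children] at h
  have : Q.k = Q'.k - 1 := by rw [← h]; rfl
  have h2 : -Q.k = -Q'.k + 1 := by omega
  rw [area, area, side, side, h2, zpow_add_one₀ two_ne_zero]
  ring

end DyadicSquare

/-- If the averages of `Φ` over the children of a square dominate `g + Φ`, then the sum of
`|Q| g(Q)` over a tree telescopes to the values of `Φ` on the leaves. -/
theorem FiniteConvexTree.sum_area_mul_le (𝒯 : FiniteConvexTree) {Φ g : DyadicSquare → ℝ} {K : ℝ}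
    (hg : ∀ Q ∈ 𝒯.squares, g Q + Φ Q ≤ (∑ Q' ∈ Q.children, Φ Q') / 4)
    (hK : ∀ Q, Q ∈ 𝒯.squares ∨ Q ∈ 𝒯.leaves → Φ Q ≤ K) (h0 : 0 ≤ Φ 𝒯.top) :
    ∑ Q ∈ 𝒯.squares, Q.area * g Q ≤ K * 𝒯.top.area := by
  classical
  have hdis : (𝒯.squares : Set DyadicSquare).PairwiseDisjoint DyadicSquare.children := by
    intro Q _ Q' _ hne
    rw [Function.onFun, Finset.disjoint_left]
    intro P hP hP'
    rw [DyadicSquare.mem_children] at hP hP'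
    exact hne (hP.symm.trans hP')
  have hsub : 𝒯.squares.erase 𝒯.top ⊆ 𝒯.squares.biUnion DyadicSquare.children := by
    intro Q hQ
    obtain ⟨hne, hQ⟩ := Finset.mem_erase.1 hQ
    refine Finset.mem_biUnion.2 ⟨Q.parent, ?_, DyadicSquare.mem_children.2 rfl⟩
    exact 𝒯.convex Q hQ _ 𝒯.top_mem _ Q.subset_parent
      (DyadicSquare.parent_subset (𝒯.subset_top Q hQ) hne)
  have hnn : ∀ Q ∈ 𝒯.squares.biUnion DyadicSquare.children, 0 ≤ Q.area * (K - Φ Q) := by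
    intro Q hQ
    obtain ⟨P, hP, hQP⟩ := Finset.mem_biUnion.1 hQ
    rw [DyadicSquare.mem_children] at hQP
    refine mul_nonneg Q.area_pos.le (sub_nonneg.2 (hK Q ?_))
    by_cases h : Q ∈ 𝒯.squares
    · exact Or.inl h
    · exact Or.inr ⟨h, hQP ▸ hP⟩
  have h1 : ∑ Q ∈ 𝒯.squares, Q.area * g Q ≤ ∑ Q ∈ 𝒯.squares,
      (Q.area * (K - Φ Q) - ∑ Q' ∈ Q.children, Q'.area * (K - Φ Q')) := by
    refine Finset.sum_le_sum fun Q hQ => ?_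
    have h2 : ∑ Q' ∈ Q.children, Q'.area * (K - Φ Q')
        = Q.area / 4 * ∑ Q' ∈ Q.children, (K - Φ Q') := by
      rw [Finset.mul_sum]
      exact Finset.sum_congr rfl fun Q' hQ' => by rw [DyadicSquare.area_child hQ']
    have h3 := hg Q hQ
    rw [DyadicSquare.sum_children] at h3
    rw [h2, DyadicSquare.sum_children]
    nlinarith [Q.area_pos]
  rw [Finset.sum_sub_distrib, ← Finset.sum_biUnion hdis] at h1
  have h2 := Finset.sum_le_sum_of_subset_of_nonneg hsub fun Q hQ _ => hnn Q hQ
  have h3 := Finset.add_sum_erase 𝒯.squares (fun Q => Q.area * (K - Φ Q)) 𝒯.top_mem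
  have h4 := 𝒯.top.area_pos
  nlinarith

/-! ### A bipartite Hölder inequality -/

section Holder

variable {ι κ α β : Type*} [MeasurableSpace α] [MeasurableSpace β]

/-- Hölder's inequality for finitely many functions on a probability space, with exponents whose
reciprocals sum to at most one. -/
theorem lintegral_prod_rpow_le (μ : Measure α) [IsProbabilityMeasure μ] [Fintype ι]
    {g : ι → α → ℝ≥0∞} (hg : ∀ i, Measurable (g i)) {θ : ι → ℝ} (h0 : ∀ i, 0 ≤ θ i)
    (h1 : ∑ i, θ i ≤ 1) :
    ∫⁻ x, ∏ i, g i x ^ θ i ∂μ ≤ ∏ i, (∫⁻ x, g i x ∂μ) ^ θ i := by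
  have h := ENNReal.lintegral_prod_norm_pow_le (μ := μ) (Finset.univ : Finset (Option ι))
    (f := fun o => o.elim (fun _ => 1) g) (p := fun o => o.elim (1 - ∑ i, θ i) θ)
    (by rintro (_ | i) - <;> simp [(hg _).aemeasurable]) (by simp)
    (by rintro (_ | i) - <;> simp [h0, h1])
  simpa using h

theorem lintegral_pi_prod [Fintype ι] (μ : Measure α) [IsProbabilityMeasure μ]
    {g : ι → α → ℝ≥0∞} (hg : ∀ i, Measurable (g i)) :
    ∫⁻ x : ι → α, ∏ i, g i (x i) ∂Measure.pi (fun _ => μ) = ∏ i, ∫⁻ x, g i x ∂μ := by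
  have hi : ProbabilityTheory.iIndepFun (fun i (x : ι → α) => g i (x i))
      (Measure.pi fun _ => μ) :=
    ProbabilityTheory.iIndepFun_pi fun i => (hg i).aemeasurable
  have h := ProbabilityTheory.lintegral_prod_eq_prod_lintegral_of_indepFun Finset.univ _ hi
    (fun i => (hg i).comp (measurable_pi_apply i))
  rw [h]
  refine Finset.prod_congr rfl fun i _ => ?_
  exact (measurePreserving_eval (fun _ => μ) i).lintegral_comp (hg i)

/-- A bipartite Hölder inequality: the integral of a product of functions, each of one
`x`-variable and one `y`-variable, is at most one if the functions are normalized in `L^{1/θ}` and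
the exponents `θ` of the functions of any given variable sum to at most one. -/
theorem lintegral_bipartite_le [Fintype ι] [Fintype κ] (μ : Measure α) (ν : Measure β)
    [IsProbabilityMeasure μ] [IsProbabilityMeasure ν] {g : ι → κ → α × β → ℝ≥0∞}
    (hg : ∀ i j, Measurable (g i j)) {θ : ι → κ → ℝ} (h0 : ∀ i j, 0 ≤ θ i j)
    (hrow : ∀ i, ∑ j, θ i j ≤ 1) (hcol : ∀ j, ∑ i, θ i j ≤ 1)
    (h1 : ∀ i j, ∫⁻ z, g i j z ∂μ.prod ν ≤ 1) :
    ∫⁻ y : κ → β, ∏ i, ∫⁻ x, ∏ j, g i j (x, y j) ^ θ i j ∂μ ∂Measure.pi (fun _ => ν) ≤ 1 := by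
  have hm : ∀ i j, Measurable fun y => ∫⁻ x, g i j (x, y) ∂μ := fun i j =>
    Measurable.lintegral_prod_left' (hg i j)
  calc ∫⁻ y : κ → β, ∏ i, ∫⁻ x, ∏ j, g i j (x, y j) ^ θ i j ∂μ ∂Measure.pi (fun _ => ν)
      ≤ ∫⁻ y : κ → β, ∏ j, ∏ i, (∫⁻ x, g i j (x, y j) ∂μ) ^ θ i j
          ∂Measure.pi (fun _ => ν) := by
        refine lintegral_mono fun y => ?_
        rw [Finset.prod_comm]
        refine Finset.prod_le_prod' fun i _ => ?_
        exact lintegral_prod_rpow_le μ (fun j => (hg i j).comp measurable_prodMk_right)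
          (h0 i) (hrow i)
    _ = ∏ j, ∫⁻ y, ∏ i, (∫⁻ x, g i j (x, y) ∂μ) ^ θ i j ∂ν :=
        lintegral_pi_prod ν (g := fun j y => ∏ i, (∫⁻ x, g i j (x, y) ∂μ) ^ θ i j) fun j =>
          Finset.measurable_prod _ fun i _ => (hm i j).pow_const _
    _ ≤ ∏ j, ∏ i, (∫⁻ y, ∫⁻ x, g i j (x, y) ∂μ ∂ν) ^ θ i j :=
        Finset.prod_le_prod' fun j _ =>
          lintegral_prod_rpow_le ν (fun i => hm i j) (fun i => h0 i j) (hcol j)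
    _ ≤ 1 := by
        refine Finset.prod_le_one' fun j _ => Finset.prod_le_one' fun i _ => ?_
        refine ENNReal.rpow_le_one ?_ (h0 i j)
        rw [← lintegral_prod_symm' _ (hg i j)]
        exact h1 i j

end Holder

/-! ### Bounded measurable functions -/

section BddMeasurable

variable {ι α β : Type*} [MeasurableSpace α] [MeasurableSpace β]

/-- Measurable and bounded real functions. -/
structure BddMeasurable (f : α → ℝ) : Prop where
  measurable : Measurable f
  bounded : ∃ M : ℝ, ∀ x, |f x| ≤ M

namespace BddMeasurable

variable {f g : α → ℝ}

theorem const (c : ℝ) : BddMeasurable fun _ : α => c := ⟨measurable_const, |c|, fun _ => le_rfl⟩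

theorem mul (hf : BddMeasurable f) (hg : BddMeasurable g) : BddMeasurable fun x => f x * g x := by
  obtain ⟨hf, M, hM⟩ := hf
  obtain ⟨hg, N, hN⟩ := hg
  refine ⟨hf.mul hg, M * N, fun x => ?_⟩
  rw [abs_mul]
  exact mul_le_mul (hM x) (hN x) (abs_nonneg _) ((abs_nonneg _).trans (hM x))

theorem add (hf : BddMeasurable f) (hg : BddMeasurable g) : BddMeasurable fun x => f x + g x := by
  obtain ⟨hf, M, hM⟩ := hf
  obtain ⟨hg, N, hN⟩ := hg
  exact ⟨hf.add hg, M + N, fun x => (abs_add_le _ _).trans (add_le_add (hM x) (hN x))⟩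

theorem const_mul (hf : BddMeasurable f) (c : ℝ) : BddMeasurable fun x => c * f x :=
  (const c).mul hf

theorem sub (hf : BddMeasurable f) (hg : BddMeasurable g) : BddMeasurable fun x => f x - g x := by
  simpa [sub_eq_add_neg] using hf.add (hg.const_mul (-1))

theorem div_const (hf : BddMeasurable f) (c : ℝ) : BddMeasurable fun x => f x / c := by
  simpa [div_eq_inv_mul] using hf.const_mul c⁻¹

theorem abs (hf : BddMeasurable f) : BddMeasurable fun x => |f x| := by
  obtain ⟨hf, M, hM⟩ := hf
  exact ⟨hf.abs, M, fun x => by simpa using hM x⟩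

theorem finset_prod {s : Finset ι} {f : ι → α → ℝ} (hf : ∀ i ∈ s, BddMeasurable (f i)) :
    BddMeasurable fun x => ∏ i ∈ s, f i x := by
  classical
  induction s using Finset.induction_on with
  | empty => simpa using const 1
  | insert i s hi ih =>
    simp only [Finset.prod_insert hi]
    exact (hf i (Finset.mem_insert_self i s)).mul
      (ih fun j hj => hf j (Finset.mem_insert_of_mem hj))

theorem finset_sum {s : Finset ι} {f : ι → α → ℝ} (hf : ∀ i ∈ s, BddMeasurable (f i)) :
    BddMeasurable fun x => ∑ i ∈ s, f i x := by
  classical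
  induction s using Finset.induction_on with
  | empty => simpa using const 0
  | insert i s hi ih =>
    simp only [Finset.sum_insert hi]
    exact (hf i (Finset.mem_insert_self i s)).add
      (ih fun j hj => hf j (Finset.mem_insert_of_mem hj))

theorem pow (hf : BddMeasurable f) (n : ℕ) : BddMeasurable fun x => f x ^ n := by
  simpa using finset_prod (s := Finset.range n) fun _ _ => hf

theorem comp (hf : BddMeasurable f) {φ : β → α} (hφ : Measurable φ) :
    BddMeasurable fun y => f (φ y) := by
  obtain ⟨hf, M, hM⟩ := hf
  exact ⟨hf.comp hφ, M, fun y => hM _⟩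

theorem integrable (hf : BddMeasurable f) (μ : Measure α) [IsFiniteMeasure μ] :
    Integrable f μ := by
  obtain ⟨hf, M, hM⟩ := hf
  exact Integrable.of_bound hf.aestronglyMeasurable M (.of_forall hM)

theorem integral {f : α × β → ℝ} (hf : BddMeasurable f) (μ : Measure α) [IsFiniteMeasure μ] :
    BddMeasurable fun y => ∫ x, f (x, y) ∂μ := by
  obtain ⟨hf, M, hM⟩ := hf
  refine ⟨(hf.stronglyMeasurable.integral_prod_left' (μ := μ)).measurable,
    M * μ.real Set.univ, fun y => ?_⟩
  rw [← Real.norm_eq_abs]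
  exact norm_integral_le_of_norm_le_const (.of_forall fun x => hM (x, y))

end BddMeasurable

/-- The weighted Cauchy–Schwarz inequality for bounded measurable functions. -/
theorem sq_integral_mul_le (μ : Measure α) [IsFiniteMeasure μ] {f g w : α → ℝ}
    (hf : BddMeasurable f) (hg : BddMeasurable g) (hw : BddMeasurable w) (hw0 : ∀ x, 0 ≤ w x) :
    (∫ x, f x * g x * w x ∂μ) ^ 2 ≤ (∫ x, f x ^ 2 * w x ∂μ) * ∫ x, g x ^ 2 * w x ∂μ := by
  have h : ∀ t : ℝ, 0 ≤ (∫ x, g x ^ 2 * w x ∂μ) * (t * t)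
      + (-2 * ∫ x, f x * g x * w x ∂μ) * t + ∫ x, f x ^ 2 * w x ∂μ := by
    intro t
    have h1 : ∫ x, (f x - t * g x) ^ 2 * w x ∂μ = (∫ x, g x ^ 2 * w x ∂μ) * (t * t)
        + (-2 * ∫ x, f x * g x * w x ∂μ) * t + ∫ x, f x ^ 2 * w x ∂μ := by
      rw [mul_comm _ (t * t), mul_right_comm (-2), ← integral_const_mul, ← integral_const_mul,
        ← integral_add, ← integral_add]
      · refine integral_congr_ae (.of_forall fun x => ?_)
        ring
      · exact ((((hg.pow 2).mul hw).const_mul _).add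
          (((hf.mul hg).mul hw).const_mul _)).integrable μ
      · exact ((hf.pow 2).mul hw).integrable μ
      · exact (((hg.pow 2).mul hw).const_mul _).integrable μ
      · exact (((hf.mul hg).mul hw).const_mul _).integrable μ
    rw [← h1]
    exact integral_nonneg fun x => mul_nonneg (sq_nonneg _) (hw0 x)
  have h2 := discrim_le_zero h
  rw [discrim] at h2
  nlinarith

end BddMeasurable

/-! ### Convexity of powers -/

theorem mul_le_half_pow_add_pow {a b : ℝ} (ha : 0 ≤ a) (hb : 0 ≤ b) (n : ℕ) :
    (a + b) / 2 * ((a ^ n + b ^ n) / 2) ≤ (a ^ (n + 1) + b ^ (n + 1)) / 2 := by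
  have h : 0 ≤ (a - b) * (a ^ n - b ^ n) := by
    rcases le_total a b with h | h
    · exact mul_nonneg_of_nonpos_of_nonpos (by linarith)
        (by linarith [pow_le_pow_left₀ ha h n])
    · exact mul_nonneg (by linarith) (by linarith [pow_le_pow_left₀ hb h n])
  rw [pow_succ, pow_succ]
  nlinarith

theorem half_add_pow_le {a b : ℝ} (ha : 0 ≤ a) (hb : 0 ≤ b) (n : ℕ) :
    ((a + b) / 2) ^ n ≤ (a ^ n + b ^ n) / 2 := by
  induction n with
  | zero => norm_num
  | succ n ih =>
    rw [pow_succ']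
    exact (mul_le_mul_of_nonneg_left ih (by linarith)).trans (mul_le_half_pow_add_pow ha hb n)

/-- Quantitative midpoint convexity of the `p`-th power. -/
theorem half_add_pow_add_le {a b : ℝ} (ha : 0 ≤ a) (hb : 0 ≤ b) {p : ℕ} (hp : 2 ≤ p) :
    ((a + b) / 2) ^ p + ((a - b) / 2) ^ 2 * ((a + b) / 2) ^ (p - 2) ≤ (a ^ p + b ^ p) / 2 := by
  obtain ⟨n, rfl⟩ := Nat.exists_eq_add_of_le' hp
  rw [Nat.add_sub_cancel]
  induction n with
  | zero => exact le_of_eq (by ring)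
  | succ n ih =>
    refine le_trans (le_of_eq ?_) ((mul_le_mul_of_nonneg_left (ih (by omega))
      (show 0 ≤ (a + b) / 2 by linarith)).trans (mul_le_half_pow_add_pow ha hb (n + 2)))
    ring

/-! ### The symmetrized entangled form -/

section Form

variable {ι κ R C α β : Type*} [Fintype κ] [MeasurableSpace α]

/-- The average `∫ ∏ₗ F_{r,c(l)}(x, y_l) dμ(x)` over the `x`-variable of a row of type `r`. -/
def rowAvg (F : R → C → α × β → ℝ) (μ : Measure α) (c : κ → C) (r : R) (y : κ → β) : ℝ :=
  ∫ x, ∏ l, F r (c l) (x, y l) ∂μ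

theorem rowAvg_nonneg {F : R → C → α × β → ℝ} (hF : ∀ r c z, 0 ≤ F r c z) (μ : Measure α)
    (c : κ → C) (r : R) (y : κ → β) : 0 ≤ rowAvg F μ c r y :=
  integral_nonneg fun _ => Finset.prod_nonneg fun _ _ => hF _ _ _

theorem sum_rowAvg_nonneg [Fintype R] {F : R → C → α × β → ℝ} (hF : ∀ r c z, 0 ≤ F r c z) (μ : Measure α)
    (c : κ → C) {v : R → ℝ} (hv : ∀ r, 0 ≤ v r) (y : κ → β) :
    0 ≤ ∑ r, v r * rowAvg F μ c r y :=
  Finset.sum_nonneg fun r _ => mul_nonneg (hv r) (rowAvg_nonneg hF μ c r y)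

variable [MeasurableSpace β]

theorem bddMeasurable_rowAvg {F : R → C → α × β → ℝ} (hF : ∀ r c, BddMeasurable (F r c))
    (μ : Measure α) [IsFiniteMeasure μ] (c : κ → C) (r : R) : BddMeasurable (rowAvg F μ c r) :=
  BddMeasurable.integral (f := fun p : α × (κ → β) => ∏ l, F r (c l) (p.1, p.2 l))
    (BddMeasurable.finset_prod fun l _ => (hF r (c l)).comp
      (φ := fun p : α × (κ → β) => (p.1, p.2 l)) (by fun_prop)) μ

theorem rowAvg_half {F : R → C → α × β → ℝ} (hF : ∀ r c, BddMeasurable (F r c))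
    {μ μ₀ μ₁ : Measure α} [IsFiniteMeasure μ₀] [IsFiniteMeasure μ₁]
    (hμ : μ = (2⁻¹ : ℝ≥0∞) • (μ₀ + μ₁)) (c : κ → C) (r : R) (y : κ → β) :
    rowAvg F μ c r y = (rowAvg F μ₀ c r y + rowAvg F μ₁ c r y) / 2 := by
  have h : BddMeasurable fun x => ∏ l, F r (c l) (x, y l) :=
    BddMeasurable.finset_prod fun l _ => (hF r (c l)).comp measurable_prodMk_right
  exact integral_half hμ (h.integrable μ₀) (h.integrable μ₁)

variable [Fintype R]

theorem bddMeasurable_sum_rowAvg {F : R → C → α × β → ℝ} (hF : ∀ r c, BddMeasurable (F r c))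
    (μ : Measure α) [IsFiniteMeasure μ] (c : κ → C) (v : R → ℝ) :
    BddMeasurable fun y => ∑ r, v r * rowAvg F μ c r y :=
  BddMeasurable.finset_sum fun r _ => (bddMeasurable_rowAvg hF μ c r).const_mul _

theorem sum_rowAvg_half {F : R → C → α × β → ℝ} (hF : ∀ r c, BddMeasurable (F r c))
    {μ μ₀ μ₁ : Measure α} [IsFiniteMeasure μ₀] [IsFiniteMeasure μ₁]
    (hμ : μ = (2⁻¹ : ℝ≥0∞) • (μ₀ + μ₁)) (c : κ → C) (v : R → ℝ) (y : κ → β) :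
    ∑ r, v r * rowAvg F μ c r y
      = ((∑ r, v r * rowAvg F μ₀ c r y) + ∑ r, v r * rowAvg F μ₁ c r y) / 2 := by
  simp_rw [rowAvg_half hF hμ, ← Finset.sum_add_distrib, Finset.sum_div]
  exact Finset.sum_congr rfl fun r _ => by ring

variable [Fintype ι] [DecidableEq κ] [Fintype C]

/-- The entangled form with `ι`-many `x`-variables and `κ`-many `y`-variables, in which every
`x`-variable carries a row label, every `y`-variable carries a column label, the edge between an
`x`-variable labelled `r` and a `y`-variable labelled `c` carries `F r c`, and one sums over all
labellings with weights `v` and `w`. In other words, it is the fully symmetric form of the single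
function `((x, r), (y, c)) ↦ F r c (x, y)`, which makes it separately convex in `μ` and `ν`. -/
def symForm (ι κ : Type*) [Fintype ι] [Fintype κ] [DecidableEq κ]
    (F : R → C → α × β → ℝ) (v : R → ℝ) (w : C → ℝ) (μ : Measure α) (ν : Measure β) : ℝ :=
  ∑ c : κ → C, (∏ l, w (c l)) *
    ∫ y : κ → β, (∑ r, v r * rowAvg F μ c r y) ^ Fintype.card ι ∂Measure.pi fun _ => ν

/-- The expansion of the symmetrized form over the row labellings. -/
theorem symForm_eq_sum [DecidableEq ι] (F : R → C → α × β → ℝ) (hF : ∀ r c, BddMeasurable (F r c))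
    (v : R → ℝ) (w : C → ℝ) (μ : Measure α) (ν : Measure β) [IsFiniteMeasure μ]
    [IsFiniteMeasure ν] :
    symForm ι κ F v w μ ν = ∑ c : κ → C, ∑ r : ι → R, (∏ l, w (c l)) * ((∏ k, v (r k)) *
      ∫ y : κ → β, ∏ k, rowAvg F μ c (r k) y ∂Measure.pi fun _ => ν) := by
  classical
  refine Finset.sum_congr rfl fun c _ => ?_
  rw [← Finset.mul_sum]
  congr 1
  have h : ∀ y : κ → β, (∑ r, v r * rowAvg F μ c r y) ^ Fintype.card ι
      = ∑ r : ι → R, (∏ k, v (r k)) * ∏ k, rowAvg F μ c (r k) y := by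
    intro y
    rw [← Finset.card_univ, ← Finset.prod_const, Finset.prod_univ_sum, Fintype.piFinset_univ]
    exact Finset.sum_congr rfl fun r _ => Finset.prod_mul_distrib
  simp_rw [h]
  rw [integral_finsetSum]
  · exact Finset.sum_congr rfl fun r _ => integral_const_mul _ _
  · exact fun r _ => ((BddMeasurable.finset_prod fun k _ =>
      bddMeasurable_rowAvg hF μ c (r k)).const_mul _).integrable _

/-- The form is symmetric in the two groups of variables. -/
theorem symForm_swap [DecidableEq ι] (F : R → C → α × β → ℝ) (hF : ∀ r c, BddMeasurable (F r c))
    (v : R → ℝ) (w : C → ℝ) (μ : Measure α) (ν : Measure β) [IsFiniteMeasure μ]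
    [IsFiniteMeasure ν] :
    symForm ι κ F v w μ ν = symForm κ ι (fun c r z => F r c z.swap) w v ν μ := by
  rw [symForm_eq_sum F hF, symForm_eq_sum _ fun c r => (hF r c).comp measurable_swap,
    Finset.sum_comm]
  refine Finset.sum_congr rfl fun r _ => Finset.sum_congr rfl fun c _ => ?_
  have hb : BddMeasurable fun p : (κ → β) × (ι → α) =>
      ∏ k, ∏ l, F (r k) (c l) (p.2 k, p.1 l) :=
    BddMeasurable.finset_prod fun k _ => BddMeasurable.finset_prod fun l _ =>
      (hF (r k) (c l)).comp (φ := fun p : (κ → β) × (ι → α) => (p.2 k, p.1 l)) (by fun_prop)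
  have h1 : ∀ y : κ → β, ∏ k, rowAvg F μ c (r k) y
      = ∫ x : ι → α, ∏ k, ∏ l, F (r k) (c l) (x k, y l) ∂Measure.pi fun _ => μ := fun y =>
    (integral_fintype_prod_eq_prod
      (fun k x => ∏ l, F (r k) (c l) (x, y l)) (μ := fun _ => μ)).symm
  have h2 : ∀ x : ι → α, ∏ l, rowAvg (fun c r z => F r c z.swap) ν r (c l) x
      = ∫ y : κ → β, ∏ k, ∏ l, F (r k) (c l) (x k, y l) ∂Measure.pi fun _ => ν := fun x => by
    simp_rw [Finset.prod_comm (s := (Finset.univ : Finset ι))]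
    exact (integral_fintype_prod_eq_prod
      (fun l y => ∏ k, F (r k) (c l) (x k, y)) (μ := fun _ => ν)).symm
  simp_rw [h1, h2]
  rw [integral_integral_swap (hb.integrable _)]
  ring

theorem symForm_half_left_le {F : R → C → α × β → ℝ} (hF : ∀ r c, BddMeasurable (F r c))
    (hF0 : ∀ r c z, 0 ≤ F r c z) {v : R → ℝ} (hv : ∀ r, 0 ≤ v r) {w : C → ℝ} (hw : ∀ c, 0 ≤ w c)
    {μ μ₀ μ₁ : Measure α} [IsFiniteMeasure μ₀] [IsFiniteMeasure μ₁]
    (hμ : μ = (2⁻¹ : ℝ≥0∞) • (μ₀ + μ₁)) (ν : Measure β) [IsFiniteMeasure ν] :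
    symForm ι κ F v w μ ν ≤ (symForm ι κ F v w μ₀ ν + symForm ι κ F v w μ₁ ν) / 2 := by
  have hb := fun (μ : Measure α) [IsFiniteMeasure μ] (c : κ → C) =>
    ((bddMeasurable_sum_rowAvg hF μ c v).pow (Fintype.card ι)).integrable
      (Measure.pi fun _ => ν)
  unfold symForm
  rw [← Finset.sum_add_distrib, Finset.sum_div]
  refine Finset.sum_le_sum fun c _ => ?_
  rw [← mul_add, mul_div_assoc, ← integral_add (hb μ₀ c) (hb μ₁ c), ← integral_div]
  refine mul_le_mul_of_nonneg_left ?_ (Finset.prod_nonneg fun l _ => hw _)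
  simp_rw [sum_rowAvg_half hF hμ]
  refine integral_mono_of_nonneg (.of_forall fun y => ?_) (((hb μ₀ c).add (hb μ₁ c)).div_const 2)
    (.of_forall fun y => half_add_pow_le (sum_rowAvg_nonneg hF0 _ c hv y)
      (sum_rowAvg_nonneg hF0 _ c hv y) _)
  have h0 := sum_rowAvg_nonneg hF0 μ₀ c hv y
  have h1 := sum_rowAvg_nonneg hF0 μ₁ c hv y
  exact pow_nonneg (by linarith) _

theorem symForm_half_right_le [DecidableEq ι] {F : R → C → α × β → ℝ} (hF : ∀ r c, BddMeasurable (F r c))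
    (hF0 : ∀ r c z, 0 ≤ F r c z) {v : R → ℝ} (hv : ∀ r, 0 ≤ v r) {w : C → ℝ} (hw : ∀ c, 0 ≤ w c)
    (μ : Measure α) [IsFiniteMeasure μ] {ν ν₀ ν₁ : Measure β} [IsFiniteMeasure ν]
    [IsFiniteMeasure ν₀] [IsFiniteMeasure ν₁] (hν : ν = (2⁻¹ : ℝ≥0∞) • (ν₀ + ν₁)) :
    symForm ι κ F v w μ ν ≤ (symForm ι κ F v w μ ν₀ + symForm ι κ F v w μ ν₁) / 2 := by
  rw [symForm_swap F hF, symForm_swap F hF, symForm_swap F hF]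
  exact symForm_half_left_le (fun c r => (hF r c).comp measurable_swap)
    (fun c r z => hF0 r c z.swap) hw hv hν μ

/-- Splitting the `x`-measure increases the form at least by a square function in the row
differences. -/
theorem symForm_add_le {F : R → C → α × β → ℝ} (hF : ∀ r c, BddMeasurable (F r c))
    (hF0 : ∀ r c z, 0 ≤ F r c z) {v : R → ℝ} (hv : ∀ r, 0 ≤ v r) {p : ℕ}
    (hι : Fintype.card ι = p) (hp : 2 ≤ p) {μ μ₀ μ₁ : Measure α} [IsFiniteMeasure μ]
    [IsFiniteMeasure μ₀] [IsFiniteMeasure μ₁]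
    (hμ : μ = (2⁻¹ : ℝ≥0∞) • (μ₀ + μ₁)) (ν : Measure β) [IsFiniteMeasure ν] (c₀ : κ → C) :
    symForm ι κ F v (fun _ => 1) μ ν
      + ∫ y, (∑ r, v r * ((rowAvg F μ₀ c₀ r y - rowAvg F μ₁ c₀ r y) / 2)) ^ 2
          * (∑ r, v r * rowAvg F μ c₀ r y) ^ (p - 2) ∂Measure.pi (fun _ => ν)
      ≤ (symForm ι κ F v (fun _ => 1) μ₀ ν + symForm ι κ F v (fun _ => 1) μ₁ ν) / 2 := by
  have hb := fun (μ : Measure α) [IsFiniteMeasure μ] (c : κ → C) =>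
    ((bddMeasurable_sum_rowAvg hF μ c v).pow p).integrable (Measure.pi fun _ => ν)
  have hd : ∀ (c : κ → C) y,
      ∑ r, v r * ((rowAvg F μ₀ c r y - rowAvg F μ₁ c r y) / 2)
        = ((∑ r, v r * rowAvg F μ₀ c r y) - ∑ r, v r * rowAvg F μ₁ c r y) / 2 := by
    intro c y
    simp_rw [← Finset.sum_sub_distrib, Finset.sum_div]
    exact Finset.sum_congr rfl fun r _ => by ring
  have hg : ∀ c : κ → C, BddMeasurable fun y =>
      (∑ r, v r * ((rowAvg F μ₀ c r y - rowAvg F μ₁ c r y) / 2)) ^ 2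
          * (∑ r, v r * rowAvg F μ c r y) ^ (p - 2) := by
    intro c
    simp_rw [hd]
    exact ((((bddMeasurable_sum_rowAvg hF μ₀ c v).sub
      (bddMeasurable_sum_rowAvg hF μ₁ c v)).div_const 2).pow 2).mul
        ((bddMeasurable_sum_rowAvg hF μ c v).pow _)
  have hg0 : ∀ c : κ → C, 0 ≤ ∫ y, (∑ r, v r * ((rowAvg F μ₀ c r y - rowAvg F μ₁ c r y) / 2)) ^ 2
      * (∑ r, v r * rowAvg F μ c r y) ^ (p - 2) ∂Measure.pi (fun _ => ν) := fun c =>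
    integral_nonneg fun y => mul_nonneg (sq_nonneg _)
      (pow_nonneg (sum_rowAvg_nonneg hF0 μ c hv y) _)
  refine (add_le_add_right (Finset.single_le_sum (fun c _ => hg0 c) (Finset.mem_univ c₀)) _).trans
    ?_
  unfold symForm
  simp only [Finset.prod_const_one, one_mul, hι]
  rw [← Finset.sum_add_distrib, ← Finset.sum_add_distrib, Finset.sum_div]
  refine Finset.sum_le_sum fun c _ => ?_
  rw [← integral_add (hb μ₀ c) (hb μ₁ c), ← integral_div,
    ← integral_add (hb μ c) ((hg c).integrable _)]
  refine integral_mono ((hb μ c).add ((hg c).integrable _))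
    (((hb μ₀ c).add (hb μ₁ c)).div_const 2) fun y => ?_
  simp only [hd]
  rw [sum_rowAvg_half hF hμ]
  exact half_add_pow_add_le (sum_rowAvg_nonneg hF0 _ c hv y) (sum_rowAvg_nonneg hF0 _ c hv y) hp

end Form

/-! ### Normalized functions -/

section Normalized

variable {ι κ R C α β : Type*} [MeasurableSpace α] [MeasurableSpace β]

/-- `f` is the `θ`-th power of a function of integral at most one. For `θ = 1 / d` this says that
`f` has `L^d` norm at most one; for `θ = 0` it says that `f` is the constant function `1`. -/
def IsNormalized (θ : ℝ) (f : α × β → ℝ) (μ : Measure α) (ν : Measure β) : Prop :=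
  ∃ g : α × β → ℝ≥0∞, Measurable g ∧ (∀ z, ENNReal.ofReal (f z) = g z ^ θ) ∧
    ∫⁻ z, g z ∂μ.prod ν ≤ 1

theorem isNormalized_one (θ : ℝ) (μ : Measure α) (ν : Measure β) [IsProbabilityMeasure μ]
    [IsProbabilityMeasure ν] : IsNormalized θ (fun _ : α × β => 1) μ ν :=
  ⟨fun _ => 1, measurable_const, by simp, by simp⟩

theorem IsNormalized.swap {θ : ℝ} {f : α × β → ℝ} {μ : Measure α} {ν : Measure β}
    [SFinite μ] [SFinite ν] (h : IsNormalized θ f μ ν) :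
    IsNormalized θ (fun z => f z.swap) ν μ := by
  obtain ⟨g, hg, hfg, h1⟩ := h
  refine ⟨fun z => g z.swap, hg.comp measurable_swap, fun z => hfg _, ?_⟩
  rwa [lintegral_prod_swap]

theorem integral_prod_rowAvg_le_one [Fintype ι] [Fintype κ] {F : ι → κ → α × β → ℝ}
    (hF : ∀ i j, BddMeasurable (F i j)) (hF0 : ∀ i j z, 0 ≤ F i j z)
    {μ : Measure α} {ν : Measure β} [IsProbabilityMeasure μ] [IsProbabilityMeasure ν]
    {θ : ι → κ → ℝ} (h0 : ∀ i j, 0 ≤ θ i j) (hrow : ∀ i, ∑ j, θ i j ≤ 1)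
    (hcol : ∀ j, ∑ i, θ i j ≤ 1) (h1 : ∀ i j, IsNormalized (θ i j) (F i j) μ ν) :
    ∫ y : κ → β, ∏ i, ∫ x, ∏ j, F i j (x, y j) ∂μ ∂Measure.pi (fun _ => ν) ≤ 1 := by
  choose g hg hFg hg1 using h1
  have hb : ∀ y : κ → β, ∀ i, BddMeasurable fun x => ∏ j, F i j (x, y j) := fun y i =>
    BddMeasurable.finset_prod fun j _ => (hF i j).comp measurable_prodMk_right
  have hn : ∀ y : κ → β, ∀ i, 0 ≤ ∫ x, ∏ j, F i j (x, y j) ∂μ := fun y i =>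
    integral_nonneg fun x => Finset.prod_nonneg fun j _ => hF0 _ _ _
  have hB : BddMeasurable fun y : κ → β => ∏ i, ∫ x, ∏ j, F i j (x, y j) ∂μ :=
    BddMeasurable.finset_prod fun i _ => bddMeasurable_rowAvg (fun i j => hF i j) μ id i
  rw [← ENNReal.ofReal_le_one, ofReal_integral_eq_lintegral_ofReal (hB.integrable _)
    (.of_forall fun y => Finset.prod_nonneg fun i _ => hn y i)]
  refine le_trans (le_of_eq ?_) (lintegral_bipartite_le μ ν hg h0 hrow hcol hg1)
  refine lintegral_congr fun y => ?_
  rw [ENNReal.ofReal_prod_of_nonneg fun i _ => hn y i]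
  refine Finset.prod_congr rfl fun i _ => ?_
  rw [ofReal_integral_eq_lintegral_ofReal ((hb y i).integrable _)
    (.of_forall fun x => Finset.prod_nonneg fun j _ => hF0 _ _ _)]
  refine lintegral_congr fun x => ?_
  rw [ENNReal.ofReal_prod_of_nonneg fun j _ => hF0 _ _ _]
  exact Finset.prod_congr rfl fun j _ => hFg i j _

theorem sum_le_one_of_le [Fintype ι] {p : ℕ} (hp : 0 < p) (hι : Fintype.card ι ≤ p)
    {t : ι → ℝ} (ht : ∀ i, t i ≤ 1 / p) : ∑ i, t i ≤ 1 := by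
  have hp' : (0 : ℝ) < p := by exact_mod_cast hp
  calc ∑ i, t i ≤ ∑ _i : ι, (1 / p : ℝ) := Finset.sum_le_sum fun i _ => ht i
    _ = Fintype.card ι / p := by simp [div_eq_mul_inv]
    _ ≤ 1 := (div_le_one hp').2 (by exact_mod_cast hι)

theorem symForm_nonneg [Fintype ι] [Fintype κ] [Fintype R] [Fintype C] [DecidableEq κ]
    {F : R → C → α × β → ℝ} (hF0 : ∀ r c z, 0 ≤ F r c z)
    {v : R → ℝ} (hv : ∀ r, 0 ≤ v r) {w : C → ℝ} (hw : ∀ c, 0 ≤ w c) (μ : Measure α)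
    (ν : Measure β) : 0 ≤ symForm ι κ F v w μ ν :=
  Finset.sum_nonneg fun c _ => mul_nonneg (Finset.prod_nonneg fun _ _ => hw _)
    (integral_nonneg fun y => pow_nonneg (sum_rowAvg_nonneg hF0 μ c hv y) _)

theorem symForm_le [Fintype ι] [Fintype κ] [Fintype R] [Fintype C] [DecidableEq ι]
    [DecidableEq κ] {F : R → C → α × β → ℝ} (hF : ∀ r c, BddMeasurable (F r c))
    (hF0 : ∀ r c z, 0 ≤ F r c z) {v : R → ℝ} (hv : ∀ r, 0 ≤ v r) {w : C → ℝ} (hw : ∀ c, 0 ≤ w c)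
    {μ : Measure α} {ν : Measure β} [IsProbabilityMeasure μ] [IsProbabilityMeasure ν]
    {p : ℕ} (hι : Fintype.card ι ≤ p) (hκ : Fintype.card κ ≤ p) (hp : 0 < p)
    {θ : R → C → ℝ} (h0 : ∀ r c, 0 ≤ θ r c) (hθ : ∀ r c, θ r c ≤ 1 / p)
    (h1 : ∀ r c, IsNormalized (θ r c) (F r c) μ ν) :
    symForm ι κ F v w μ ν ≤ (∑ c : κ → C, ∏ l, w (c l)) * ∑ r : ι → R, ∏ k, v (r k) := by
  rw [symForm_eq_sum F hF, Finset.sum_mul_sum]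
  refine Finset.sum_le_sum fun c _ => Finset.sum_le_sum fun r _ =>
    mul_le_mul_of_nonneg_left ?_ (Finset.prod_nonneg fun _ _ => hw _)
  refine mul_le_of_le_one_right (Finset.prod_nonneg fun _ _ => hv _) ?_
  exact integral_prod_rowAvg_le_one (F := fun k l => F (r k) (c l)) (fun _ _ => hF _ _)
    (fun _ _ => hF0 _ _) (θ := fun k l => θ (r k) (c l)) (fun _ _ => h0 _ _)
    (fun k => sum_le_one_of_le hp hκ fun l => hθ _ _)
    (fun l => sum_le_one_of_le hp hι fun k => hθ _ _)
    fun _ _ => h1 _ _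

end Normalized

/-! ### Domination of the square function of a component -/

section Component

variable {ι κ α β : Type*}

theorem sum_fun_prod_eq_pow [Fintype ι] [DecidableEq ι] [Fintype κ] (v : κ → ℝ) :
    ∑ r : ι → κ, ∏ k, v (r k) = (∑ i, v i) ^ Fintype.card ι := by
  rw [← Finset.card_univ, ← Finset.prod_const, Finset.prod_univ_sum, Fintype.piFinset_univ]

/-- The family `F` with one additional row consisting of the constant function `1`. -/
def addRow (F : ι → κ → α × β → ℝ) : Option ι → κ → α × β → ℝ :=
  fun r c => r.elim (fun _ => 1) fun i => F i c

theorem addRow_nonneg {F : ι → κ → α × β → ℝ} (hF0 : ∀ i j z, 0 ≤ F i j z) :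
    ∀ r c z, 0 ≤ addRow F r c z
  | none, _, _ => zero_le_one
  | some _, _, _ => hF0 _ _ _

variable [MeasurableSpace α] [MeasurableSpace β]

theorem bddMeasurable_addRow {F : ι → κ → α × β → ℝ} (hF : ∀ i j, BddMeasurable (F i j)) :
    ∀ r c, BddMeasurable (addRow F r c)
  | none, _ => BddMeasurable.const 1
  | some i, j => hF i j

/-- The Bellman function of a component: the sum of two symmetrized forms. The second one gives
double weight to the row `i₀`, so that together their increments control the difference in the row
`i₀` alone, without cancellation against the differences in the other rows. -/
def bellman [Fintype ι] [DecidableEq ι] [Fintype κ] [DecidableEq κ] (p : ℕ)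
    (F : ι → κ → α × β → ℝ) (i₀ : ι) (μ : Measure α) (ν : Measure β) : ℝ :=
  symForm (Fin p) κ (addRow F) (fun _ => 1) (fun _ => 1) μ ν
    + symForm (Fin p) κ (addRow F) (fun r => if r = some i₀ then 2 else 1) (fun _ => 1) μ ν

variable [Fintype ι] [DecidableEq ι] [Fintype κ] [DecidableEq κ]

theorem bellman_nonneg {F : ι → κ → α × β → ℝ} (hF0 : ∀ i j z, 0 ≤ F i j z) (p : ℕ) (i₀ : ι)
    (μ : Measure α) (ν : Measure β) : 0 ≤ bellman p F i₀ μ ν :=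
  add_nonneg (symForm_nonneg (addRow_nonneg hF0) (by simp) (by simp) μ ν)
    (symForm_nonneg (addRow_nonneg hF0) (fun r => by positivity) (by simp) μ ν)

/-- An upper bound for `bellman`, see `bellman_le`. -/
def bellmanBound (ι κ : Type*) [Fintype ι] [Fintype κ] (p : ℕ) : ℝ :=
  (Fintype.card κ : ℝ) ^ Fintype.card κ
      * ((Fintype.card ι + 1) ^ p + (Fintype.card ι + 2) ^ p)

theorem bellman_le {F : ι → κ → α × β → ℝ} (hF : ∀ i j, BddMeasurable (F i j))
    (hF0 : ∀ i j z, 0 ≤ F i j z) {p : ℕ} (hκ : Fintype.card κ ≤ p) (hp : 0 < p) (i₀ : ι)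
    {μ : Measure α} {ν : Measure β} [IsProbabilityMeasure μ] [IsProbabilityMeasure ν]
    {θ : ι → κ → ℝ} (h0 : ∀ i j, 0 ≤ θ i j) (hθ : ∀ i j, θ i j ≤ 1 / p)
    (h1 : ∀ i j, IsNormalized (θ i j) (F i j) μ ν) :
    bellman p F i₀ μ ν ≤ bellmanBound ι κ p := by
  have key : ∀ v : Option ι → ℝ, (∀ r, 0 ≤ v r) →
      symForm (Fin p) κ (addRow F) v (fun _ => 1) μ ν
        ≤ (Fintype.card κ : ℝ) ^ Fintype.card κ * (∑ r, v r) ^ p := by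
    intro v hv
    refine (symForm_le (bddMeasurable_addRow hF) (addRow_nonneg hF0) hv (w := fun _ => 1)
      (by simp) (p := p) (by simp) hκ hp (θ := fun r c => r.elim 0 fun i => θ i c) ?_ ?_ ?_).trans
      (le_of_eq ?_)
    · rintro (_ | i) j
      · exact le_rfl
      · exact h0 i j
    · rintro (_ | i) j
      · change (0 : ℝ) ≤ 1 / p
        positivity
      · exact hθ i j
    · rintro (_ | i) j
      · exact isNormalized_one 0 μ ν
      · exact h1 i j
    · rw [sum_fun_prod_eq_pow v, sum_fun_prod_eq_pow fun _ : κ => 1]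
      simp
  rw [bellman, bellmanBound, mul_add]
  refine add_le_add ((key _ (by simp)).trans (le_of_eq ?_))
    ((key _ fun r => by positivity).trans (le_of_eq ?_))
  · simp
  · congr 2
    have : ∀ r : Option ι, (if r = some i₀ then (2 : ℝ) else 1)
        = 1 + if r = some i₀ then 1 else 0 := fun r => by split_ifs <;> norm_num
    simp_rw [this, Finset.sum_add_distrib]
    simp
    ring

/-- The increment of the Bellman function under splitting the `x`-measure controls the row
difference of the row `i₀`, integrated against the remaining rows. -/
theorem sq_integral_add_bellman_le {F : ι → κ → α × β → ℝ} (hF : ∀ i j, BddMeasurable (F i j))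
    (hF0 : ∀ i j z, 0 ≤ F i j z) {p : ℕ} (hι : Fintype.card ι ≤ p) (hp : 2 ≤ p) (i₀ : ι)
    {μ μ₀ μ₁ : Measure α} {ν : Measure β} [IsProbabilityMeasure μ]
    [IsFiniteMeasure μ₀] [IsFiniteMeasure μ₁] [IsFiniteMeasure ν]
    (hμ : μ = (2⁻¹ : ℝ≥0∞) • (μ₀ + μ₁)) {K : ℝ} (hK : bellman p F i₀ μ ν ≤ K) (hK0 : 0 < K) :
    (∫ y : κ → β, |(rowAvg F μ₀ id i₀ y - rowAvg F μ₁ id i₀ y) / 2|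
        * ∏ i ∈ Finset.univ.erase i₀, rowAvg F μ id i y ∂Measure.pi fun _ => ν) ^ 2
      + 2 * K * bellman p F i₀ μ ν
      ≤ (2 * K * bellman p F i₀ μ₀ ν + 2 * K * bellman p F i₀ μ₁ ν) / 2 := by
  have hG := bddMeasurable_addRow hF
  have hG0 := addRow_nonneg hF0
  have hv0 : ∀ r : Option ι, 0 ≤ (if r = some i₀ then (2 : ℝ) else 1) := fun r => by positivity
  set π : Measure (κ → β) := Measure.pi fun _ => ν with hπ
  set G := addRow F with hGdef
  set D : Option ι → (κ → β) → ℝ := fun r y => (rowAvg G μ₀ id r y - rowAvg G μ₁ id r y) / 2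
    with hD
  set U : (κ → β) → ℝ := fun y => ∑ r : Option ι, 1 * rowAvg G μ id r y with hU
  have hsome : ∀ (μ : Measure α) i y, rowAvg G μ id (some i) y = rowAvg F μ id i y :=
    fun _ _ _ => rfl
  have hUb : BddMeasurable U := bddMeasurable_sum_rowAvg hG μ id _
  have hDb : ∀ r, BddMeasurable (D r) := fun r =>
    ((bddMeasurable_rowAvg hG μ₀ id r).sub (bddMeasurable_rowAvg hG μ₁ id r)).div_const 2
  have hUle : ∀ r y, rowAvg G μ id r y ≤ U y := fun r y => by
    have := Finset.single_le_sum (f := fun r => rowAvg G μ id r y)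
      (fun r _ => rowAvg_nonneg hG0 μ id r y) (Finset.mem_univ r)
    simpa [hU] using this
  have hU1 : ∀ y, 1 ≤ U y := fun y => by
    have h := hUle none y
    have h2 : rowAvg G μ id none y = 1 := by
      simp [rowAvg, hGdef, addRow]
    linarith
  -- the increments of the two forms
  have g1 := symForm_add_le (ι := Fin p) hG hG0 (v := fun _ => 1) (by simp) (Fintype.card_fin p) hp
    hμ ν (id : κ → κ)
  have g2 := symForm_add_le (ι := Fin p) hG hG0 hv0 (Fintype.card_fin p) hp hμ ν (id : κ → κ)
  have hd : ∀ y, ∑ r, (if r = some i₀ then (2 : ℝ) else 1) * D r y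
      = (∑ r, 1 * D r y) + D (some i₀) y := by
    intro y
    have : ∀ r : Option ι, (if r = some i₀ then (2 : ℝ) else 1) * D r y
        = 1 * D r y + if r = some i₀ then D r y else 0 := fun r => by
      split_ifs <;> ring
    simp_rw [this, Finset.sum_add_distrib]
    simp
  have hu : ∀ y, U y ≤ ∑ r, (if r = some i₀ then (2 : ℝ) else 1) * rowAvg G μ id r y := by
    intro y
    refine Finset.sum_le_sum fun r _ => mul_le_mul_of_nonneg_right ?_ (rowAvg_nonneg hG0 μ id r y)
    split_ifs <;> norm_num
  have hsq : BddMeasurable fun y => D (some i₀) y ^ 2 * U y ^ (p - 2) :=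
    ((hDb _).pow 2).mul (hUb.pow _)
  have hb1 : BddMeasurable fun y => (∑ r, 1 * D r y) ^ 2 * U y ^ (p - 2) :=
    ((BddMeasurable.finset_sum fun r _ => (hDb r).const_mul 1).pow 2).mul (hUb.pow _)
  have hb2 : BddMeasurable fun y => (∑ r, (if r = some i₀ then (2 : ℝ) else 1) * D r y) ^ 2
      * (∑ r, (if r = some i₀ then (2 : ℝ) else 1) * rowAvg G μ id r y) ^ (p - 2) :=
    ((BddMeasurable.finset_sum fun r _ => (hDb r).const_mul _).pow 2).mul
      ((bddMeasurable_sum_rowAvg hG μ id _).pow _)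
  have hgain : ∫ y, D (some i₀) y ^ 2 * U y ^ (p - 2) ∂π
      ≤ 2 * ((∫ y, (∑ r, 1 * D r y) ^ 2 * U y ^ (p - 2) ∂π)
        + ∫ y, (∑ r, (if r = some i₀ then (2 : ℝ) else 1) * D r y) ^ 2
          * (∑ r, (if r = some i₀ then (2 : ℝ) else 1) * rowAvg G μ id r y) ^ (p - 2) ∂π) := by
    rw [← integral_add (hb1.integrable _) (hb2.integrable _), ← integral_const_mul]
    refine integral_mono (hsq.integrable _) (((hb1.add hb2).const_mul 2).integrable _) fun y => ?_
    have hU0 : 0 ≤ U y := zero_le_one.trans (hU1 y)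
    have h1 : U y ^ (p - 2)
        ≤ (∑ r, (if r = some i₀ then (2 : ℝ) else 1) * rowAvg G μ id r y) ^ (p - 2) :=
      pow_le_pow_left₀ hU0 (hu y) _
    have h2 := mul_le_mul_of_nonneg_left h1
      (sq_nonneg (∑ r, (if r = some i₀ then (2 : ℝ) else 1) * D r y))
    refine le_trans ?_ (mul_le_mul_of_nonneg_left (add_le_add_right h2 _) zero_le_two)
    rw [hd, ← add_mul, ← mul_assoc]
    refine mul_le_mul_of_nonneg_right ?_ (pow_nonneg hU0 _)
    nlinarith [sq_nonneg ((∑ r, 1 * D r y) + (∑ r, 1 * D r y) + D (some i₀) y)]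
  have hcs := sq_integral_mul_le π (hDb (some i₀)).abs hUb (hUb.pow (p - 2))
    fun y => pow_nonneg (zero_le_one.trans (hU1 y)) _
  simp only [sq_abs] at hcs
  have hUp : ∫ y, U y ^ 2 * U y ^ (p - 2) ∂π ≤ K := by
    simp_rw [← pow_add, Nat.add_sub_cancel' hp]
    have h1 : ∫ y, U y ^ p ∂π ≤ symForm (Fin p) κ G (fun _ => 1) (fun _ => 1) μ ν := by
      have := Finset.single_le_sum (f := fun c : κ → κ => ∫ y,
          (∑ r, 1 * rowAvg G μ c r y) ^ p ∂π)
        (fun c _ => integral_nonneg fun y => pow_nonneg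
          (sum_rowAvg_nonneg hG0 μ c (by simp) y) _) (Finset.mem_univ id)
      simpa [symForm, hU] using this
    exact h1.trans (((le_add_iff_nonneg_right _).2
      (symForm_nonneg hG0 hv0 (by simp) μ ν)).trans hK)
  have hle : ∫ y, |(rowAvg F μ₀ id i₀ y - rowAvg F μ₁ id i₀ y) / 2|
        * ∏ i ∈ Finset.univ.erase i₀, rowAvg F μ id i y ∂π
      ≤ ∫ y, |D (some i₀) y| * U y * U y ^ (p - 2) ∂π := by
    refine integral_mono_of_nonneg (.of_forall fun y => mul_nonneg (abs_nonneg _)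
        (Finset.prod_nonneg fun i _ => rowAvg_nonneg hF0 μ id i y))
      ((((hDb _).abs.mul hUb).mul (hUb.pow _)).integrable _) (.of_forall fun y => ?_)
    simp only
    rw [mul_assoc, ← pow_succ']
    refine mul_le_mul_of_nonneg_left ?_ (abs_nonneg _)
    calc ∏ i ∈ Finset.univ.erase i₀, rowAvg F μ id i y
        ≤ ∏ _i ∈ Finset.univ.erase i₀, U y :=
          Finset.prod_le_prod (fun i _ => rowAvg_nonneg hF0 μ id i y) fun i _ => hUle (some i) y
      _ = U y ^ (Fintype.card ι - 1) := by
          rw [Finset.prod_const, Finset.card_erase_of_mem (Finset.mem_univ _), Finset.card_univ]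
      _ ≤ U y ^ (p - 2 + 1) := pow_le_pow_right₀ (hU1 y) (by omega)
  have hle0 : 0 ≤ ∫ y, |(rowAvg F μ₀ id i₀ y - rowAvg F μ₁ id i₀ y) / 2|
        * ∏ i ∈ Finset.univ.erase i₀, rowAvg F μ id i y ∂π :=
    integral_nonneg fun y => mul_nonneg (abs_nonneg _)
        (Finset.prod_nonneg fun i _ => rowAvg_nonneg hF0 μ id i y)
  have hI0 : 0 ≤ ∫ y, D (some i₀) y ^ 2 * U y ^ (p - 2) ∂π :=
    integral_nonneg fun y => mul_nonneg (sq_nonneg _)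
      (pow_nonneg (zero_le_one.trans (hU1 y)) _)
  have h1 := (pow_le_pow_left₀ hle0 hle 2).trans
    (hcs.trans (mul_le_mul_of_nonneg_left hUp hI0))
  have h2 := mul_le_mul_of_nonneg_right hgain hK0.le
  have h3 := mul_le_mul_of_nonneg_left (add_le_add g1 g2) hK0.le
  simp only [bellman]
  linarith

end Component

/-! ### Averages of entangled products -/

section EntangledAvg

variable {ι κ α β : Type*} [Fintype κ] [MeasurableSpace α] [MeasurableSpace β]

theorem abs_integral_mul_prod_le {F : ι → κ → α × β → ℝ} (hF : ∀ i j, BddMeasurable (F i j))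
    (hF0 : ∀ i j z, 0 ≤ F i j z) {a : α → ℝ} (ha1 : ∀ x, |a x| ≤ 1) (μ : Measure α)
    [IsFiniteMeasure μ] (i : ι) (y : κ → β) :
    |∫ x, a x * ∏ j, F i j (x, y j) ∂μ| ≤ rowAvg F μ id i y := by
  have h : BddMeasurable fun x => ∏ j, F i j (x, y j) :=
    BddMeasurable.finset_prod fun j _ => (hF i j).comp measurable_prodMk_right
  refine abs_integral_le_integral_abs.trans (integral_mono_of_nonneg
    (.of_forall fun x => abs_nonneg _) (h.integrable _) (.of_forall fun x => ?_))
  simp only [id]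
  rw [abs_mul, abs_of_nonneg (Finset.prod_nonneg fun j _ => hF0 _ _ _)]
  exact mul_le_of_le_one_left (Finset.prod_nonneg fun j _ => hF0 _ _ _) (ha1 x)

variable [Fintype ι]

/-- The integral of `∏ᵢ aᵢ(xᵢ) ∏ⱼ bⱼ(yⱼ) ∏ᵢⱼ F i j (xᵢ, yⱼ)` over all variables, each `x`-variable
being distributed according to `μ` and each `y`-variable according to `ν`, with the integrals in
the `x`-variables carried out first. -/
def entangledAvg (F : ι → κ → α × β → ℝ) (a : ι → α → ℝ) (b : κ → β → ℝ) (μ : Measure α)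
    (ν : Measure β) : ℝ :=
  ∫ y : κ → β, (∏ j, b j (y j)) * ∏ i, ∫ x, a i x * ∏ j, F i j (x, y j) ∂μ
    ∂Measure.pi fun _ => ν

theorem integral_prod_eq_entangledAvg {F : ι → κ → α × β → ℝ}
    (hF : ∀ i j, BddMeasurable (F i j)) {a : ι → α → ℝ} (ha : ∀ i, BddMeasurable (a i))
    {b : κ → β → ℝ} (hb : ∀ j, BddMeasurable (b j)) (μ : Measure α) (ν : Measure β)
    [IsProbabilityMeasure μ] [IsProbabilityMeasure ν] :
    ∫ p : (ι → α) × (κ → β), (∏ i, ∏ j, F i j (p.1 i, p.2 j))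
        * ((∏ i, a i (p.1 i)) * ∏ j, b j (p.2 j))
        ∂(Measure.pi fun _ => μ).prod (Measure.pi fun _ => ν)
      = entangledAvg F a b μ ν := by
  have h : BddMeasurable fun p : (ι → α) × (κ → β) => (∏ i, ∏ j, F i j (p.1 i, p.2 j))
        * ((∏ i, a i (p.1 i)) * ∏ j, b j (p.2 j)) := by
    refine BddMeasurable.mul (BddMeasurable.finset_prod fun i _ => BddMeasurable.finset_prod
      fun j _ => (hF i j).comp (φ := fun p : (ι → α) × (κ → β) => (p.1 i, p.2 j)) (by fun_prop))
      (BddMeasurable.mul (BddMeasurable.finset_prod fun i _ =>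
        (ha i).comp (φ := fun p : (ι → α) × (κ → β) => p.1 i) (by fun_prop))
        (BddMeasurable.finset_prod fun j _ =>
          (hb j).comp (φ := fun p : (ι → α) × (κ → β) => p.2 j) (by fun_prop)))
  rw [integral_prod_symm _ (h.integrable _), entangledAvg]
  congr 1
  ext y
  rw [← integral_fintype_prod_eq_prod (fun i x => a i x * ∏ j, F i j (x, y j))
    (μ := fun _ => μ), ← integral_const_mul]
  congr 1
  ext x
  simp only
  rw [Finset.prod_mul_distrib]
  ring

theorem entangledAvg_swap {F : ι → κ → α × β → ℝ}
    (hF : ∀ i j, BddMeasurable (F i j)) {a : ι → α → ℝ} (ha : ∀ i, BddMeasurable (a i))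
    {b : κ → β → ℝ} (hb : ∀ j, BddMeasurable (b j)) (μ : Measure α) (ν : Measure β)
    [IsProbabilityMeasure μ] [IsProbabilityMeasure ν] :
    entangledAvg F a b μ ν = entangledAvg (fun j i z => F i j z.swap) b a ν μ := by
  rw [← integral_prod_eq_entangledAvg hF ha hb,
    ← integral_prod_eq_entangledAvg (fun j i => (hF i j).comp measurable_swap) hb ha,
    ← integral_prod_swap]
  congr 1
  ext p
  simp only [Prod.swap]
  rw [Finset.prod_comm]
  ring

/-- If the constant function `1` sits on every edge between the vertices selected by `P`, `P'` and
the remaining vertices, then the average factorizes. -/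
theorem entangledAvg_eq_mul (P : ι → Prop) (P' : κ → Prop) [DecidablePred P] [DecidablePred P']
    {F : ι → κ → α × β → ℝ} (h1 : ∀ i j, P i → ¬ P' j → ∀ z, F i j z = 1)
    (h2 : ∀ i j, ¬ P i → P' j → ∀ z, F i j z = 1) (a : ι → α → ℝ) (b : κ → β → ℝ)
    (μ : Measure α) (ν : Measure β) [IsProbabilityMeasure μ] [IsProbabilityMeasure ν] :
    entangledAvg F a b μ ν
      = entangledAvg (fun (i : {i // P i}) (j : {j // P' j}) => F i j) (fun i => a i)
          (fun j => b j) μ ν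
        * entangledAvg (fun (i : {i // ¬ P i}) (j : {j // ¬ P' j}) => F i j) (fun i => a i)
          (fun j => b j) μ ν := by
  have hmp := measurePreserving_piEquivPiSubtypeProd (fun _ : κ => ν) P'
  unfold entangledAvg
  rw [← integral_prod_mul, ← hmp.integral_comp']
  congr 1
  ext y
  simp only [MeasurableEquiv.piEquivPiSubtypeProd, Equiv.piEquivPiSubtypeProd_apply,
    MeasurableEquiv.coe_mk]
  have hi : ∀ i, P i → ∀ x, ∏ j, F i j (x, y j) = ∏ j : {j // P' j}, F i j (x, y j) := by
    intro i hi x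
    rw [← Fintype.prod_subtype_mul_prod_subtype P' fun j => F i j (x, y j)]
    rw [Finset.prod_eq_one (s := (Finset.univ : Finset {j // ¬ P' j})), mul_one]
    exact fun j _ => h1 i j hi j.2 _
  have hi' : ∀ i, ¬ P i → ∀ x, ∏ j, F i j (x, y j) = ∏ j : {j // ¬ P' j}, F i j (x, y j) := by
    intro i hi x
    rw [← Fintype.prod_subtype_mul_prod_subtype P' fun j => F i j (x, y j)]
    rw [Finset.prod_eq_one (s := (Finset.univ : Finset {j // P' j})), one_mul]
    exact fun j _ => h2 i j hi j.2 _
  rw [← Fintype.prod_subtype_mul_prod_subtype P' fun j => b j (y j),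
    ← Fintype.prod_subtype_mul_prod_subtype P fun i => ∫ x, a i x * ∏ j, F i j (x, y j) ∂μ]
  have e1 : ∏ i : {i // P i}, ∫ x, a i x * ∏ j, F i j (x, y j) ∂μ
      = ∏ i : {i // P i}, ∫ x, a i x * ∏ j : {j // P' j}, F i j (x, y j) ∂μ :=
    Finset.prod_congr rfl fun i _ => by simp_rw [hi i i.2]
  have e2 : ∏ i : {i // ¬ P i}, ∫ x, a i x * ∏ j, F i j (x, y j) ∂μ
      = ∏ i : {i // ¬ P i}, ∫ x, a i x * ∏ j : {j // ¬ P' j}, F i j (x, y j) ∂μ :=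
    Finset.prod_congr rfl fun i _ => by simp_rw [hi' i i.2]
  rw [e1, e2]
  ring

theorem abs_entangledAvg_le {F : ι → κ → α × β → ℝ} {a : ι → α → ℝ} {b : κ → β → ℝ}
    (hb1 : ∀ j y, |b j y| ≤ 1) {μ : Measure α} {ν : Measure β} [IsFiniteMeasure ν]
    {G : (κ → β) → ℝ} (hG : BddMeasurable G)
    (h : ∀ y, ∏ i, |∫ x, a i x * ∏ j, F i j (x, y j) ∂μ| ≤ G y) :
    |entangledAvg F a b μ ν| ≤ ∫ y, G y ∂Measure.pi fun _ => ν := by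
  refine abs_integral_le_integral_abs.trans (integral_mono_of_nonneg
    (.of_forall fun x => abs_nonneg _) (hG.integrable _) (.of_forall fun y => ?_))
  simp only
  rw [abs_mul, Finset.abs_prod, Finset.abs_prod]
  refine (mul_le_of_le_one_left (Finset.prod_nonneg fun i _ => abs_nonneg _) ?_).trans (h y)
  exact Finset.prod_le_one (fun j _ => abs_nonneg _) fun j _ => hb1 _ _

theorem abs_entangledAvg_le_one {F : ι → κ → α × β → ℝ}
    (hF : ∀ i j, BddMeasurable (F i j)) (hF0 : ∀ i j z, 0 ≤ F i j z)
    {a : ι → α → ℝ} (ha1 : ∀ i x, |a i x| ≤ 1) {b : κ → β → ℝ} (hb1 : ∀ j y, |b j y| ≤ 1)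
    {μ : Measure α} {ν : Measure β} [IsProbabilityMeasure μ] [IsProbabilityMeasure ν]
    {θ : ι → κ → ℝ} (h0 : ∀ i j, 0 ≤ θ i j) (hrow : ∀ i, ∑ j, θ i j ≤ 1)
    (hcol : ∀ j, ∑ i, θ i j ≤ 1) (h1 : ∀ i j, IsNormalized (θ i j) (F i j) μ ν) :
    |entangledAvg F a b μ ν| ≤ 1 := by
  refine (abs_entangledAvg_le hb1 (G := fun y => ∏ i, rowAvg F μ id i y)
    (BddMeasurable.finset_prod fun i _ => bddMeasurable_rowAvg hF μ id i) fun y => ?_).trans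
    (integral_prod_rowAvg_le_one hF hF0 h0 hrow hcol h1)
  exact Finset.prod_le_prod (fun i _ => abs_nonneg _) fun i _ =>
    abs_integral_mul_prod_le hF hF0 (ha1 i) μ i y

end EntangledAvg

/-- Functions of one variable that are either the Haar function or the characteristic function of
a dyadic interval. -/
def haarOrChar (c : Prop) [Decidable c] (k l : ℤ) : ℝ → ℝ := if c then haar k l else charFn k l

theorem bddMeasurable_haar (k l : ℤ) : BddMeasurable (haar k l) :=
  ⟨measurable_haar k l, 1, abs_haar_le_one k l⟩

theorem bddMeasurable_charFn (k l : ℤ) : BddMeasurable (charFn k l) :=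
  ⟨measurable_charFn k l, 1, abs_charFn_le_one k l⟩

theorem bddMeasurable_haarOrChar (c : Prop) [Decidable c] (k l : ℤ) :
    BddMeasurable (haarOrChar c k l) := by
  unfold haarOrChar
  split_ifs
  exacts [bddMeasurable_haar k l, bddMeasurable_charFn k l]

theorem abs_haarOrChar_le_one (c : Prop) [Decidable c] (k l : ℤ) (t : ℝ) :
    |haarOrChar c k l t| ≤ 1 := by
  unfold haarOrChar
  split_ifs
  exacts [abs_haar_le_one k l t, abs_charFn_le_one k l t]

theorem haarOrChar_of_notMem {c : Prop} [Decidable c] {k l : ℤ} {t : ℝ}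
    (ht : t ∉ dyadicInterval k l) : haarOrChar c k l t = 0 := by
  unfold haarOrChar
  split_ifs
  exacts [haar_of_notMem ht, charFn_of_notMem ht]

/-- The average of a component, with a Haar function in the variable `x_{i₀}`, is bounded by the
integrated row difference. -/
theorem abs_entangledAvg_haar_le {ι κ : Type*} [Fintype ι] [DecidableEq ι] [Fintype κ]
    {F : ι → κ → ℝ × ℝ → ℝ}
    (hF : ∀ i j, BddMeasurable (F i j)) (hF0 : ∀ i j z, 0 ≤ F i j z) (i₀ : ι) {k l : ℤ}
    {a : ι → ℝ → ℝ} (ha1 : ∀ i x, |a i x| ≤ 1) (ha : a i₀ = haar k l) {b : κ → ℝ → ℝ}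
    (hb1 : ∀ j y, |b j y| ≤ 1) (ν : Measure ℝ) [IsFiniteMeasure ν] :
    |entangledAvg F a b (avgMeasure k l) ν|
      ≤ ∫ y : κ → ℝ, |(rowAvg F (avgMeasure (k + 1) (2 * l)) id i₀ y
            - rowAvg F (avgMeasure (k + 1) (2 * l + 1)) id i₀ y) / 2|
          * ∏ i ∈ Finset.univ.erase i₀, rowAvg F (avgMeasure k l) id i y
          ∂Measure.pi fun _ => ν := by
  have hr := fun μ [IsFiniteMeasure μ] i =>
    bddMeasurable_rowAvg (κ := κ) (R := ι) (C := κ) hF μ id i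
  refine abs_entangledAvg_le hb1 ((((hr _ _).sub (hr _ _)).div_const 2).abs.mul
    (BddMeasurable.finset_prod fun i _ => hr _ _)) fun y => ?_
  have hm : BddMeasurable fun x => ∏ j, F i₀ j (x, y j) :=
    BddMeasurable.finset_prod fun j _ => (hF i₀ j).comp measurable_prodMk_right
  rw [← Finset.mul_prod_erase _ _ (Finset.mem_univ i₀), ha,
    integral_haar_mul k l hm.measurable hm.bounded]
  refine mul_le_mul_of_nonneg_left ?_ (abs_nonneg _)
  exact Finset.prod_le_prod (fun i _ => abs_nonneg _) fun i _ =>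
    abs_integral_mul_prod_le hF hF0 (ha1 i) _ i y

/-! ### Dominated families of coefficients -/

/-- The squares of the numbers `A Q`, for the squares with property `P`, are dominated by the
increments of a nonnegative function on dyadic squares that is bounded by `K` on the squares with
property `P`. -/
def IsDominated (K : ℝ) (P : DyadicSquare → Prop) (A : DyadicSquare → ℝ) : Prop :=
  ∃ Φ : DyadicSquare → ℝ, (∀ Q, 0 ≤ Φ Q) ∧ (∀ Q, P Q → Φ Q ≤ K) ∧
    ∀ Q, P Q → A Q ^ 2 + Φ Q ≤ (∑ Q' ∈ Q.children, Φ Q') / 4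

theorem IsDominated.sum_le {K : ℝ} {P : DyadicSquare → Prop} {A : DyadicSquare → ℝ}
    (h : IsDominated K P A) (𝒯 : FiniteConvexTree)
    (hP : ∀ Q, Q ∈ 𝒯.squares ∨ Q ∈ 𝒯.leaves → P Q) :
    ∑ Q ∈ 𝒯.squares, Q.area * A Q ^ 2 ≤ K * 𝒯.top.area := by
  obtain ⟨Φ, h0, hK, hΦ⟩ := h
  exact 𝒯.sum_area_mul_le (fun Q hQ => hΦ Q (hP Q (Or.inl hQ))) (fun Q hQ => hK Q (hP Q hQ))
    (h0 _)

theorem IsDominated.mono {K : ℝ} {P : DyadicSquare → Prop} {A B : DyadicSquare → ℝ}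
    (h : IsDominated K P A) (hAB : ∀ Q, P Q → |B Q| ≤ |A Q|) : IsDominated K P B := by
  obtain ⟨Φ, h0, hK, hΦ⟩ := h
  exact ⟨Φ, h0, hK, fun Q hQ =>
    (add_le_add_left (sq_le_sq.2 (hAB Q hQ)) _).trans (hΦ Q hQ)⟩

/-- The reflection of a dyadic square in the diagonal of the plane. -/
def DyadicSquare.swap (Q : DyadicSquare) : DyadicSquare := ⟨Q.k, Q.b, Q.a⟩

theorem IsDominated.swap {K : ℝ} {P : DyadicSquare → Prop} {A : DyadicSquare → ℝ}
    (h : IsDominated K P A) : IsDominated K (fun Q => P Q.swap) fun Q => A Q.swap := by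
  obtain ⟨Φ, h0, hK, hΦ⟩ := h
  refine ⟨fun Q => Φ Q.swap, fun Q => h0 _, fun Q => hK _, fun Q hQ => (hΦ _ hQ).trans ?_⟩
  simp only [DyadicSquare.sum_children, DyadicSquare.swap]
  linarith

theorem bellmanBound_pos (ι κ : Type*) [Fintype ι] [Fintype κ] (p : ℕ) : 0 < bellmanBound ι κ p := by
  have : (0 : ℝ) < (Fintype.card κ : ℝ) ^ Fintype.card κ := by
    exact_mod_cast Nat.pow_self_pos
  unfold bellmanBound
  positivity

section

variable {ι κ : Type*} [Fintype ι] [DecidableEq ι] [Fintype κ] [DecidableEq κ]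

theorem bellman_half_right_le {F : ι → κ → ℝ × ℝ → ℝ} (hF : ∀ i j, BddMeasurable (F i j))
    (hF0 : ∀ i j z, 0 ≤ F i j z) (p : ℕ) (i₀ : ι) (μ : Measure ℝ) [IsFiniteMeasure μ]
    {ν ν₀ ν₁ : Measure ℝ} [IsFiniteMeasure ν] [IsFiniteMeasure ν₀] [IsFiniteMeasure ν₁]
    (hν : ν = (2⁻¹ : ℝ≥0∞) • (ν₀ + ν₁)) :
    bellman p F i₀ μ ν ≤ (bellman p F i₀ μ ν₀ + bellman p F i₀ μ ν₁) / 2 := by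
  have h := fun (v : Option ι → ℝ) (hv : ∀ r, 0 ≤ v r) => symForm_half_right_le (ι := Fin p) (κ := κ)
    (bddMeasurable_addRow hF) (addRow_nonneg hF0) hv (w := fun _ => 1) (by simp) μ hν
  have h1 := h (fun _ => 1) (by simp)
  have h2 := h (fun r => if r = some i₀ then 2 else 1) (fun r => by positivity)
  unfold bellman
  linarith

/-- The averages of a component with at most `p` vertices on each side, `p ≥ 2`, are dominated if
there is a Haar function in the variable `x_{i₀}`. -/
theorem isDominated_of_haar_left {F : ι → κ → ℝ × ℝ → ℝ} (hF : ∀ i j, BddMeasurable (F i j))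
    (hF0 : ∀ i j z, 0 ≤ F i j z) {p : ℕ} (hι : Fintype.card ι ≤ p) (hκ : Fintype.card κ ≤ p)
    (hp : 2 ≤ p) (i₀ : ι) {a : DyadicSquare → ι → ℝ → ℝ} {b : DyadicSquare → κ → ℝ → ℝ}
    (ha1 : ∀ Q i x, |a Q i x| ≤ 1) (ha : ∀ Q, a Q i₀ = haar Q.k Q.a)
    (hb1 : ∀ Q j y, |b Q j y| ≤ 1) {θ : ι → κ → ℝ} (h0 : ∀ i j, 0 ≤ θ i j)
    (hθ : ∀ i j, θ i j ≤ 1 / p) {P : DyadicSquare → Prop}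
    (hP : ∀ Q, P Q → ∀ i j,
      IsNormalized (θ i j) (F i j) (avgMeasure Q.k Q.a) (avgMeasure Q.k Q.b)) :
    IsDominated (2 * bellmanBound ι κ p ^ 2) P fun Q =>
      entangledAvg F (a Q) (b Q) (avgMeasure Q.k Q.a) (avgMeasure Q.k Q.b) := by
  have hK0 := bellmanBound_pos ι κ p
  set K := bellmanBound ι κ p
  have hle : ∀ Q, P Q → bellman p F i₀ (avgMeasure Q.k Q.a) (avgMeasure Q.k Q.b) ≤ K :=
    fun Q hQ => bellman_le hF hF0 hκ (by omega) i₀ h0 hθ (hP Q hQ)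
  refine ⟨fun Q => 2 * K * bellman p F i₀ (avgMeasure Q.k Q.a) (avgMeasure Q.k Q.b),
    fun Q => mul_nonneg (by linarith) (bellman_nonneg hF0 p i₀ _ _), fun Q hQ => ?_,
    fun Q hQ => ?_⟩
  · have := hle Q hQ
    nlinarith
  · have h1 := sq_integral_add_bellman_le hF hF0 hι hp i₀ (avgMeasure_eq_half Q.k Q.a) (hle Q hQ)
      hK0
    have h2 := pow_le_pow_left₀ (abs_nonneg _) (abs_entangledAvg_haar_le hF hF0 i₀ (ha1 Q) (ha Q)
      (hb1 Q) (avgMeasure Q.k Q.b)) 2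
    have h3 := fun μ [IsFiniteMeasure μ] => mul_le_mul_of_nonneg_left
      (bellman_half_right_le hF hF0 p i₀ μ (avgMeasure_eq_half Q.k Q.b)) hK0.le
    have h4 := h3 (avgMeasure (Q.k + 1) (2 * Q.a))
    have h5 := h3 (avgMeasure (Q.k + 1) (2 * Q.a + 1))
    rw [sq_abs] at h2
    rw [DyadicSquare.sum_children]
    simp only
    linarith

theorem isDominated_of_haar_right {F : ι → κ → ℝ × ℝ → ℝ} (hF : ∀ i j, BddMeasurable (F i j))
    (hF0 : ∀ i j z, 0 ≤ F i j z) {p : ℕ} (hι : Fintype.card ι ≤ p) (hκ : Fintype.card κ ≤ p)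
    (hp : 2 ≤ p) (j₀ : κ) {a : DyadicSquare → ι → ℝ → ℝ} {b : DyadicSquare → κ → ℝ → ℝ}
    (ha : ∀ Q i, BddMeasurable (a Q i)) (hb : ∀ Q j, BddMeasurable (b Q j))
    (ha1 : ∀ Q i x, |a Q i x| ≤ 1) (hb1 : ∀ Q j y, |b Q j y| ≤ 1)
    (hbj : ∀ Q, b Q j₀ = haar Q.k Q.b) {θ : ι → κ → ℝ} (h0 : ∀ i j, 0 ≤ θ i j)
    (hθ : ∀ i j, θ i j ≤ 1 / p) {P : DyadicSquare → Prop}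
    (hP : ∀ Q, P Q → ∀ i j,
      IsNormalized (θ i j) (F i j) (avgMeasure Q.k Q.a) (avgMeasure Q.k Q.b)) :
    IsDominated (2 * bellmanBound κ ι p ^ 2) P fun Q =>
      entangledAvg F (a Q) (b Q) (avgMeasure Q.k Q.a) (avgMeasure Q.k Q.b) := by
  have h := (isDominated_of_haar_left (F := fun j i z => F i j z.swap)
    (fun j i => (hF i j).comp measurable_swap) (fun j i z => hF0 i j _) hκ hι hp j₀
    (a := fun Q => b Q.swap) (b := fun Q => a Q.swap) (fun Q => hb1 _) (fun Q => hbj _)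
    (fun Q => ha1 _) (θ := fun j i => θ i j) (fun j i => h0 i j) (fun j i => hθ i j)
    (P := fun Q => P Q.swap) fun Q hQ j i => (hP _ hQ i j).swap).swap
  refine IsDominated.mono h fun Q _ => le_of_eq ?_
  rw [entangledAvg_swap hF (ha Q) (hb Q)]
  rfl

end

/-- For a component consisting of a single edge there are no further variables, and the squares of
the averages themselves are a Bellman function. -/
theorem isDominated_of_unique {ι κ : Type*} [Fintype ι] [Fintype κ] [Unique ι] [Unique κ]
    {F : ι → κ → ℝ × ℝ → ℝ}
    (hF : ∀ i j, BddMeasurable (F i j)) (hF0 : ∀ i j z, 0 ≤ F i j z) {c : ι → Prop}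
    {c' : κ → Prop} [DecidablePred c] [DecidablePred c'] (hc : c default ∨ c' default)
    {θ : ι → κ → ℝ} (h0 : ∀ i j, 0 ≤ θ i j) (h1 : ∀ i j, θ i j ≤ 1) {P : DyadicSquare → Prop}
    (hP : ∀ Q, P Q → ∀ i j,
      IsNormalized (θ i j) (F i j) (avgMeasure Q.k Q.a) (avgMeasure Q.k Q.b)) :
    IsDominated 1 P fun Q => entangledAvg F (fun i => haarOrChar (c i) Q.k Q.a)
      (fun j => haarOrChar (c' j) Q.k Q.b) (avgMeasure Q.k Q.a) (avgMeasure Q.k Q.b) := by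
  set f := F default default
  have hf : BddMeasurable f := hF _ _
  set Ψ : Measure ℝ → Measure ℝ → ℝ := fun μ ν => ∫ y, ∫ x, f (x, y) ∂μ ∂ν with hΨ
  have huniq : ∀ (ν : Measure ℝ) [SigmaFinite ν] (G : ℝ → ℝ),
      ∫ y : κ → ℝ, G (y default) ∂Measure.pi (fun _ => ν) = ∫ y, G y ∂ν := by
    intro ν _ G
    exact (measurePreserving_piUnique fun _ : κ => ν).integral_comp' G
  have hint : ∀ μ [IsFiniteMeasure μ], BddMeasurable fun y => ∫ x, f (x, y) ∂μ :=
    fun μ _ => hf.integral μ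
  have hsec : ∀ y, BddMeasurable fun x => f (x, y) := fun y => hf.comp measurable_prodMk_right
  refine ⟨fun Q => Ψ (avgMeasure Q.k Q.a) (avgMeasure Q.k Q.b) ^ 2, fun Q => sq_nonneg _,
    fun Q hQ => ?_, fun Q hQ => ?_⟩
  · have h2 := integral_prod_rowAvg_le_one hF hF0 h0 (fun i => by simpa using h1 i default)
      (fun j => by simpa using h1 default j) (hP Q hQ)
    simp only [Fintype.prod_unique] at h2
    rw [huniq _ fun y => ∫ x, f (x, y) ∂avgMeasure Q.k Q.a] at h2
    refine pow_le_one₀ ?_ h2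
    exact integral_nonneg fun y => integral_nonneg fun x => hF0 _ _ _
  · obtain ⟨k, l, l'⟩ := Q
    have hA : entangledAvg F (fun i => haarOrChar (c i) k l) (fun j => haarOrChar (c' j) k l')
        (avgMeasure k l) (avgMeasure k l') = ∫ y, haarOrChar (c' default) k l' y
          * ∫ x, haarOrChar (c default) k l x * f (x, y) ∂avgMeasure k l ∂avgMeasure k l' := by
      rw [entangledAvg]
      simp only [Fintype.prod_unique]
      exact huniq _ fun y => haarOrChar (c' default) k l' y
          * ∫ x, haarOrChar (c default) k l x * f (x, y) ∂avgMeasure k l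
    -- the signs of the four children in the average
    have hx : ∃ s : ℝ, s = (if c default then -1 else 1) ∧
        ∀ y, ∫ x, haarOrChar (c default) k l x * f (x, y) ∂avgMeasure k l
          = ((∫ x, f (x, y) ∂avgMeasure (k + 1) (2 * l))
            + s * ∫ x, f (x, y) ∂avgMeasure (k + 1) (2 * l + 1)) / 2 := by
      refine ⟨_, rfl, fun y => ?_⟩
      unfold haarOrChar
      split_ifs
      · rw [integral_haar_mul k l (hsec y).measurable (hsec y).bounded]
        ring
      · rw [integral_charFn_mul, integral_half (avgMeasure_eq_half k l) ((hsec y).integrable _)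
          ((hsec y).integrable _)]
        ring
    have hy : ∃ s : ℝ, s = (if c' default then -1 else 1) ∧
        ∀ g, BddMeasurable g → ∫ y, haarOrChar (c' default) k l' y * g y ∂avgMeasure k l'
          = ((∫ y, g y ∂avgMeasure (k + 1) (2 * l'))
            + s * ∫ y, g y ∂avgMeasure (k + 1) (2 * l' + 1)) / 2 := by
      refine ⟨_, rfl, fun g hg => ?_⟩
      unfold haarOrChar
      split_ifs
      · rw [integral_haar_mul k l' hg.measurable hg.bounded]
        ring
      · rw [integral_charFn_mul, integral_half (avgMeasure_eq_half k l') (hg.integrable _)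
          (hg.integrable _)]
        ring
    obtain ⟨s, hs, hx⟩ := hx
    obtain ⟨t, ht, hy⟩ := hy
    have hμ : ∀ ν [IsFiniteMeasure ν], Ψ (avgMeasure k l) ν
        = (Ψ (avgMeasure (k + 1) (2 * l)) ν + Ψ (avgMeasure (k + 1) (2 * l + 1)) ν) / 2 := by
      intro ν _
      simp only [hΨ]
      rw [← integral_add ((hint _).integrable _) ((hint _).integrable _), ← integral_div]
      exact integral_congr_ae (.of_forall fun y => integral_half (avgMeasure_eq_half k l)
        ((hsec y).integrable _) ((hsec y).integrable _))
    have hν : ∀ μ [IsFiniteMeasure μ], Ψ μ (avgMeasure k l')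
        = (Ψ μ (avgMeasure (k + 1) (2 * l')) + Ψ μ (avgMeasure (k + 1) (2 * l' + 1))) / 2 :=
      fun μ _ => integral_half (avgMeasure_eq_half k l') ((hint μ).integrable _)
        ((hint μ).integrable _)
    have hst : ∀ ν [IsFiniteMeasure ν], ∫ y, ((∫ x, f (x, y) ∂avgMeasure (k + 1) (2 * l))
            + s * ∫ x, f (x, y) ∂avgMeasure (k + 1) (2 * l + 1)) / 2 ∂ν
        = (Ψ (avgMeasure (k + 1) (2 * l)) ν + s * Ψ (avgMeasure (k + 1) (2 * l + 1)) ν) / 2 := by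
      intro ν _
      rw [integral_div, integral_add ((hint _).integrable _)
        (((hint _).const_mul s).integrable _), integral_const_mul]
    simp only [DyadicSquare.sum_children]
    simp_rw [hA, hx]
    rw [hy _ (((hint _).add ((hint _).const_mul s)).div_const 2), hst, hst, hμ, hν, hν]
    generalize Ψ (avgMeasure (k + 1) (2 * l)) (avgMeasure (k + 1) (2 * l')) = x₁
    generalize Ψ (avgMeasure (k + 1) (2 * l)) (avgMeasure (k + 1) (2 * l' + 1)) = x₂
    generalize Ψ (avgMeasure (k + 1) (2 * l + 1)) (avgMeasure (k + 1) (2 * l')) = x₃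
    generalize Ψ (avgMeasure (k + 1) (2 * l + 1)) (avgMeasure (k + 1) (2 * l' + 1)) = x₄
    -- the four Walsh coefficients of `x₁, x₂, x₃, x₄`
    have hw := sq_nonneg (x₁ + x₂ - x₃ - x₄)
    have hw' := sq_nonneg (x₁ - x₂ + x₃ - x₄)
    have hw'' := sq_nonneg (x₁ - x₂ - x₃ + x₄)
    by_cases h : c default <;> by_cases h' : c' default <;>
      simp only [h, h', if_true, if_false] at hs ht
    · subst hs ht; nlinarith
    · subst hs ht; nlinarith
    · subst hs ht; nlinarith
    · simp [h, h'] at hc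

/-! ### Components of the bipartite graph -/

section Graph

variable {m n : ℕ} {E : Finset (Fin m × Fin n)}

theorem IsNonCancellative.exists_edge {S : Finset (Fin m)} {T : Finset (Fin n)}
    (h : IsNonCancellative E S T) (hST : S.Nonempty ∨ T.Nonempty) :
    ∃ e ∈ E, (∀ i ∈ S, i = e.1) ∧ (∀ j ∈ T, j = e.2) ∧ (e.1 ∈ S ∨ e.2 ∈ T) := by
  obtain ⟨e, he, hS, hT⟩ := h
  refine ⟨e, he, hS, hT, ?_⟩
  rcases hST with ⟨i, hi⟩ | ⟨j, hj⟩
  · exact Or.inl (hS i hi ▸ hi)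
  · exact Or.inr (hT j hj ▸ hj)

theorem bipartiteGraph_adj {i : Fin m} {j : Fin n} (h : (i, j) ∈ E) :
    (bipartiteGraph E).Adj (Sum.inl i) (Sum.inr j) := by
  rw [bipartiteGraph, SimpleGraph.fromRel_adj]
  exact ⟨Sum.inl_ne_inr, Or.inl ⟨(i, j), h, rfl, rfl⟩⟩

theorem mem_componentX_iff_mem_componentY {e : Fin m × Fin n} {i : Fin m} {j : Fin n}
    (h : (i, j) ∈ E) : i ∈ componentX E e ↔ j ∈ componentY E e :=
  ⟨fun hi => hi.trans (bipartiteGraph_adj h).reachable,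
    fun hj => hj.trans (bipartiteGraph_adj h).symm.reachable⟩

theorem fst_mem_componentX (e : Fin m × Fin n) : e.1 ∈ componentX E e :=
  SimpleGraph.Reachable.refl _

theorem snd_mem_componentY {e : Fin m × Fin n} (h : e ∈ E) : e.2 ∈ componentY E e :=
  (bipartiteGraph_adj h).reachable

theorem componentX_eq {e e' : Fin m × Fin n} (h : e'.1 ∈ componentX E e) :
    componentX E e' = componentX E e :=
  Set.ext fun _ => ⟨fun hi => SimpleGraph.Reachable.trans h hi,
    fun hi => SimpleGraph.Reachable.trans (SimpleGraph.Reachable.symm h) hi⟩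

theorem componentY_eq {e e' : Fin m × Fin n} (h : e'.1 ∈ componentX E e) :
    componentY E e' = componentY E e :=
  Set.ext fun _ => ⟨fun hi => SimpleGraph.Reachable.trans h hi,
    fun hi => SimpleGraph.Reachable.trans (SimpleGraph.Reachable.symm h) hi⟩

theorem max_ncard_le_threshold (E : Finset (Fin m × Fin n)) (e : Fin m × Fin n) :
    max (componentX E e).ncard (componentY E e).ncard ≤ threshold E e := by
  unfold threshold
  split_ifs <;> omega

theorem ncard_componentX_pos (e : Fin m × Fin n) : 0 < (componentX E e).ncard :=
  (Set.ncard_pos (Set.toFinite _)).2 ⟨e.1, fst_mem_componentX e⟩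

theorem threshold_pos (E : Finset (Fin m × Fin n)) (e : Fin m × Fin n) : 0 < threshold E e :=
  (ncard_componentX_pos e).trans_le ((le_max_left _ _).trans (max_ncard_le_threshold E e))

/-- The Hölder exponents: reciprocals of the thresholds on the edges of the graph, and zero on the
pairs that are not joined by an edge. -/
def exponent (E : Finset (Fin m × Fin n)) (i : Fin m) (j : Fin n) : ℝ :=
  if (i, j) ∈ E then 1 / threshold E (i, j) else 0

theorem exponent_nonneg (E : Finset (Fin m × Fin n)) (i : Fin m) (j : Fin n) :
    0 ≤ exponent E i j := by
  unfold exponent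
  positivity

theorem exponent_le {p : ℕ} (hp : 0 < p) {i : Fin m} {j : Fin n}
    (h : (i, j) ∈ E → p ≤ threshold E (i, j)) : exponent E i j ≤ 1 / p := by
  unfold exponent
  split_ifs with hE
  · exact one_div_le_one_div_of_le (by exact_mod_cast hp) (by exact_mod_cast h hE)
  · positivity

theorem sum_le_one_of_support {ι : Type*} [Fintype ι] {t : ι → ℝ} {s : Set ι}
    (hs : ∀ i ∉ s, t i = 0) (ht : ∀ i ∈ s, t i ≤ 1 / s.ncard) : ∑ i, t i ≤ 1 := by
  classical
  rw [Set.ncard_eq_toFinset_card'] at ht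
  rw [← Finset.sum_subset (Finset.subset_univ s.toFinset)
    fun i _ hi => hs i (by simpa using hi)]
  calc ∑ i ∈ s.toFinset, t i ≤ ∑ _i ∈ s.toFinset, (1 / s.toFinset.card : ℝ) :=
        Finset.sum_le_sum fun i hi => ht i (by simpa using hi)
    _ = s.toFinset.card / s.toFinset.card := by simp [div_eq_mul_inv]
    _ ≤ 1 := div_self_le_one _

theorem sum_exponent_row_le (E : Finset (Fin m × Fin n)) (i : Fin m) :
    ∑ j, exponent E i j ≤ 1 := by
  by_cases h : ∃ j, (i, j) ∈ E
  · obtain ⟨j₀, hj₀⟩ := h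
    have hY : ∀ j, componentY E (i, j) = componentY E (i, j₀) := fun _ => rfl
    refine sum_le_one_of_support (s := componentY E (i, j₀)) (fun j hj => ?_) fun j _ => ?_
    · exact if_neg fun h => hj (by rw [← hY j]; exact snd_mem_componentY h)
    · refine exponent_le ((Set.ncard_pos (Set.toFinite _)).2 ⟨j₀, snd_mem_componentY hj₀⟩)
        fun _ => ?_
      exact (le_max_right _ _).trans (max_ncard_le_threshold E (i, j))
  · push Not at h
    simp [exponent, h]

theorem sum_exponent_col_le (E : Finset (Fin m × Fin n)) (j : Fin n) :
    ∑ i, exponent E i j ≤ 1 := by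
  by_cases h : ∃ i, (i, j) ∈ E
  · obtain ⟨i₀, hi₀⟩ := h
    have hX : ∀ i, (i, j) ∈ E → i ∈ componentX E (i₀, j) := fun i hi =>
      (mem_componentX_iff_mem_componentY hi).2 (snd_mem_componentY hi₀)
    refine sum_le_one_of_support (s := componentX E (i₀, j)) (fun i hi => ?_) fun i _ => ?_
    · exact if_neg fun h => hi (hX i h)
    · refine exponent_le (ncard_componentX_pos _) fun hi => ?_
      rw [← componentX_eq (e' := (i, j)) (hX i hi)]
      exact (le_max_left _ _).trans (max_ncard_le_threshold E (i, j))
  · push Not at h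
    simp [exponent, h]

/-- The family of functions on all pairs of vertices, with the constant function `1` on pairs that
are not joined by an edge. -/
def fillEdges (E : Finset (Fin m × Fin n)) (F : Fin m × Fin n → ℝ × ℝ → ℝ) (i : Fin m)
    (j : Fin n) (z : ℝ × ℝ) : ℝ :=
  if (i, j) ∈ E then F (i, j) z else 1

theorem bddMeasurable_fillEdges {F : Fin m × Fin n → ℝ × ℝ → ℝ}
    (hF : ∀ e ∈ E, BddMeasurable (F e)) (i : Fin m) (j : Fin n) :
    BddMeasurable (fillEdges E F i j) := by
  unfold fillEdges
  split_ifs with h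
  exacts [hF _ h, BddMeasurable.const 1]

theorem fillEdges_nonneg {F : Fin m × Fin n → ℝ × ℝ → ℝ} (hF : ∀ e ∈ E, ∀ z, 0 ≤ F e z)
    (i : Fin m) (j : Fin n) (z : ℝ × ℝ) : 0 ≤ fillEdges E F i j z := by
  unfold fillEdges
  split_ifs with h
  exacts [hF _ h z, zero_le_one]

theorem prod_fillEdges (F : Fin m × Fin n → ℝ × ℝ → ℝ) (x : Fin m → ℝ) (y : Fin n → ℝ) :
    ∏ i, ∏ j, fillEdges E F i j (x i, y j) = ∏ e ∈ E, F e (x e.1, y e.2) := by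
  rw [← Fintype.prod_prod_type' fun i j => fillEdges E F i j (x i, y j)]
  simp [fillEdges, Finset.prod_ite_mem]

end Graph

/-! ### Paraproduct terms as entangled averages -/

theorem pi_avgMeasure (m : ℕ) (k l : ℤ) :
    (Measure.pi fun _ : Fin m => avgMeasure k l)
      = ENNReal.ofReal (2 ^ k) ^ m
        • volume.restrict (Set.univ.pi fun _ : Fin m => dyadicInterval k l) := by
  refine Measure.pi_eq fun s hs => ?_
  rw [Measure.smul_apply, Measure.restrict_apply (MeasurableSet.univ_pi hs),
    ← Set.pi_inter_distrib, volume_pi_pi]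
  simp_rw [avgMeasure, Measure.smul_apply, Measure.restrict_apply (hs _), smul_eq_mul]
  rw [Finset.prod_mul_distrib, Finset.prod_const, Finset.card_univ, Fintype.card_fin]

theorem paraproductTerm_eq {m n : ℕ} {E : Finset (Fin m × Fin n)} (S : Finset (Fin m))
    (T : Finset (Fin n)) {F : Fin m × Fin n → ℝ × ℝ → ℝ} (hF : ∀ e ∈ E, BddMeasurable (F e))
    (Q : DyadicSquare) :
    paraproductTerm E S T F Q = entangledAvg (fillEdges E F) (fun i => haarOrChar (i ∈ S) Q.k Q.a)
      (fun j => haarOrChar (j ∈ T) Q.k Q.b) (avgMeasure Q.k Q.a) (avgMeasure Q.k Q.b) := by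
  have htensor : ∀ p, tensor S T Q p = (∏ i, haarOrChar (i ∈ S) Q.k Q.a (p.1 i))
      * ∏ j, haarOrChar (j ∈ T) Q.k Q.b (p.2 j) := by
    intro p
    unfold tensor haarOrChar
    congr 1
    · exact Finset.prod_congr rfl fun i _ => by split_ifs <;> rfl
    · exact Finset.prod_congr rfl fun i _ => by split_ifs <;> rfl
  rw [← integral_prod_eq_entangledAvg (bddMeasurable_fillEdges hF)
    (fun i => bddMeasurable_haarOrChar _ _ _) fun j => bddMeasurable_haarOrChar _ _ _]
  rw [pi_avgMeasure, pi_avgMeasure, Measure.prod_smul_left, Measure.prod_smul_right,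
    Measure.prod_restrict, integral_smul_measure, integral_smul_measure, paraproductTerm,
    setIntegral_eq_integral_of_forall_compl_eq_zero]
  · simp_rw [prod_fillEdges, htensor]
    have hside : ∀ j : ℕ, (ENNReal.ofReal (2 ^ Q.k) ^ j).toReal = (Q.side ^ j)⁻¹ := fun j => by
      rw [ENNReal.toReal_pow, ENNReal.toReal_ofReal (two_zpow_pos _).le, DyadicSquare.side,
        zpow_neg, inv_pow, inv_inv]
    rw [hside, hside, smul_smul, pow_add, mul_inv, smul_eq_mul]
    rfl
  · intro p hp
    have h : (∏ i, haarOrChar (i ∈ S) Q.k Q.a (p.1 i)) * ∏ j, haarOrChar (j ∈ T) Q.k Q.b (p.2 j)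
        = 0 := by
      rw [Set.mem_prod, not_and_or, Set.mem_univ_pi, Set.mem_univ_pi, not_forall,
        not_forall] at hp
      rcases hp with ⟨i, hi⟩ | ⟨j, hj⟩
      · rw [Finset.prod_eq_zero (Finset.mem_univ i) (haarOrChar_of_notMem hi), zero_mul]
      · rw [Finset.prod_eq_zero (Finset.mem_univ j) (haarOrChar_of_notMem hj), mul_zero]
    rw [h, mul_zero]

/-! ### The square function estimate -/

section SquareFunction

variable {m n : ℕ}

open Classical in
/-- The factor of a paraproduct term that belongs to the connected component of the edge `e`. -/
def componentAvg (E : Finset (Fin m × Fin n)) (S : Finset (Fin m)) (T : Finset (Fin n))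
    (F : Fin m × Fin n → ℝ × ℝ → ℝ) (e : Fin m × Fin n) (Q : DyadicSquare) : ℝ :=
  entangledAvg (fun (i : {i // i ∈ componentX E e}) (j : {j // j ∈ componentY E e}) =>
    fillEdges E F i j) (fun i => haarOrChar (i.1 ∈ S) Q.k Q.a)
    (fun j => haarOrChar (j.1 ∈ T) Q.k Q.b) (avgMeasure Q.k Q.a) (avgMeasure Q.k Q.b)

/-- The factors of the remaining components are bounded by the bipartite Hölder inequality. -/
theorem abs_paraproductTerm_le {E : Finset (Fin m × Fin n)} (S : Finset (Fin m))
    (T : Finset (Fin n)) {F : Fin m × Fin n → ℝ × ℝ → ℝ} (hF : ∀ e ∈ E, BddMeasurable (F e))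
    (hF0 : ∀ e ∈ E, ∀ z, 0 ≤ F e z) (e : Fin m × Fin n) {Q : DyadicSquare}
    (hQ : ∀ i j, IsNormalized (exponent E i j) (fillEdges E F i j)
      (avgMeasure Q.k Q.a) (avgMeasure Q.k Q.b)) :
    |paraproductTerm E S T F Q| ≤ |componentAvg E S T F e Q| := by
  classical
  have h1 : ∀ i j, i ∈ componentX E e → j ∉ componentY E e → ∀ z, fillEdges E F i j z = 1 :=
    fun i j hi hj z => if_neg fun h => hj ((mem_componentX_iff_mem_componentY h).1 hi)
  have h2 : ∀ i j, i ∉ componentX E e → j ∈ componentY E e → ∀ z, fillEdges E F i j z = 1 :=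
    fun i j hi hj z => if_neg fun h => hi ((mem_componentX_iff_mem_componentY h).2 hj)
  rw [paraproductTerm_eq S T hF, entangledAvg_eq_mul (fun i => i ∈ componentX E e)
    (fun j => j ∈ componentY E e) h1 h2, abs_mul]
  refine (mul_le_of_le_one_right (abs_nonneg _) ?_).trans (le_of_eq ?_)
  · refine abs_entangledAvg_le_one (fun i j => bddMeasurable_fillEdges hF _ _)
      (fun i j => fillEdges_nonneg hF0 _ _) (fun i => abs_haarOrChar_le_one _ _ _)
      (fun j => abs_haarOrChar_le_one _ _ _)
      (θ := fun (i : {i // i ∉ componentX E e}) (j : {j // j ∉ componentY E e}) =>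
        exponent E i j)
      (fun i j => exponent_nonneg E _ _) (fun i => ?_) (fun j => ?_) fun i j => hQ _ _
    · refine le_trans ?_ (sum_exponent_row_le E i)
      rw [← Fintype.sum_subtype_add_sum_subtype (fun j => j ∈ componentY E e)
        fun j => exponent E i j]
      exact le_add_of_nonneg_left (Finset.sum_nonneg fun j _ => exponent_nonneg E _ _)
    · refine le_trans ?_ (sum_exponent_col_le E j)
      rw [← Fintype.sum_subtype_add_sum_subtype (fun i => i ∈ componentX E e)
        fun i => exponent E i j]
      exact le_add_of_nonneg_left (Finset.sum_nonneg fun i _ => exponent_nonneg E _ _)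
  · unfold componentAvg
    congr!

/-- Every non-cancellative paraproduct is dominated on the squares on which all the functions are
normalized. -/
theorem exists_isDominated (E : Finset (Fin m × Fin n)) (S : Finset (Fin m)) (T : Finset (Fin n))
    (hST : S.Nonempty ∨ T.Nonempty) (hnc : IsNonCancellative E S T) :
    ∃ K : ℝ, 0 ≤ K ∧ ∀ F : Fin m × Fin n → ℝ × ℝ → ℝ, (∀ e ∈ E, BddMeasurable (F e)) →
      (∀ e ∈ E, ∀ z, 0 ≤ F e z) →
      IsDominated K (fun Q => ∀ i j, IsNormalized (exponent E i j) (fillEdges E F i j)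
        (avgMeasure Q.k Q.a) (avgMeasure Q.k Q.b)) (paraproductTerm E S T F) := by
  classical
  obtain ⟨e, he, -, -, hST'⟩ := hnc.exists_edge hST
  set p := max (componentX E e).ncard (componentY E e).ncard with hp
  have hp1 : 0 < p := (ncard_componentX_pos e).trans_le (le_max_left _ _)
  have hι : Fintype.card {i // i ∈ componentX E e} ≤ p := by
    rw [← Nat.card_eq_fintype_card]
    exact le_max_left _ _
  have hκ : Fintype.card {j // j ∈ componentY E e} ≤ p := by
    rw [← Nat.card_eq_fintype_card]
    exact le_max_right _ _
  have hθ : ∀ i ∈ componentX E e, ∀ j, exponent E i j ≤ 1 / p := fun i hi j =>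
    exponent_le hp1 fun _ => by
      have h := max_ncard_le_threshold E (i, j)
      rwa [componentX_eq (e' := (i, j)) hi, componentY_eq (e' := (i, j)) hi] at h
  -- it suffices to dominate the factor of the component of `e`
  suffices h : ∃ K : ℝ, 0 ≤ K ∧ ∀ F : Fin m × Fin n → ℝ × ℝ → ℝ, (∀ e ∈ E, BddMeasurable (F e)) →
      (∀ e ∈ E, ∀ z, 0 ≤ F e z) →
      IsDominated K (fun Q => ∀ i j, IsNormalized (exponent E i j) (fillEdges E F i j)
        (avgMeasure Q.k Q.a) (avgMeasure Q.k Q.b)) (componentAvg E S T F e) by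
    obtain ⟨K, hK0, hK⟩ := h
    exact ⟨K, hK0, fun F hF hF0 => (hK F hF hF0).mono fun Q hQ =>
      abs_paraproductTerm_le S T hF hF0 e hQ⟩
  by_cases hp2 : 2 ≤ p
  · rcases hST' with h | h
    · refine ⟨2 * bellmanBound {i // i ∈ componentX E e} {j // j ∈ componentY E e} p ^ 2,
        by positivity, fun F hF hF0 => ?_⟩
      exact isDominated_of_haar_left
        (F := fun (i : {i // i ∈ componentX E e}) (j : {j // j ∈ componentY E e}) =>
          fillEdges E F i j)
        (fun i j => bddMeasurable_fillEdges hF _ _) (fun i j => fillEdges_nonneg hF0 _ _) hι hκ hp2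
        ⟨e.1, fst_mem_componentX e⟩ (a := fun Q i => haarOrChar (i.1 ∈ S) Q.k Q.a)
        (b := fun Q j => haarOrChar (j.1 ∈ T) Q.k Q.b) (fun Q i => abs_haarOrChar_le_one _ _ _)
        (fun Q => if_pos h) (fun Q j => abs_haarOrChar_le_one _ _ _)
        (θ := fun i j => exponent E i j) (fun i j => exponent_nonneg E _ _)
        (fun i j => hθ i i.2 j) fun Q hQ i j => hQ _ _
    · refine ⟨2 * bellmanBound {j // j ∈ componentY E e} {i // i ∈ componentX E e} p ^ 2,
        by positivity, fun F hF hF0 => ?_⟩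
      exact isDominated_of_haar_right
        (F := fun (i : {i // i ∈ componentX E e}) (j : {j // j ∈ componentY E e}) =>
          fillEdges E F i j)
        (fun i j => bddMeasurable_fillEdges hF _ _) (fun i j => fillEdges_nonneg hF0 _ _) hι hκ hp2
        ⟨e.2, snd_mem_componentY he⟩ (a := fun Q i => haarOrChar (i.1 ∈ S) Q.k Q.a)
        (b := fun Q j => haarOrChar (j.1 ∈ T) Q.k Q.b) (fun Q i => bddMeasurable_haarOrChar _ _ _)
        (fun Q j => bddMeasurable_haarOrChar _ _ _) (fun Q i => abs_haarOrChar_le_one _ _ _)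
        (fun Q j => abs_haarOrChar_le_one _ _ _) (fun Q => if_pos h)
        (θ := fun i j => exponent E i j) (fun i j => exponent_nonneg E _ _)
        (fun i j => hθ i i.2 j) fun Q hQ i j => hQ _ _
  · have hp' : p = 1 := by omega
    rw [hp'] at hι hκ hθ
    have := Fintype.card_le_one_iff_subsingleton.1 hι
    have := Fintype.card_le_one_iff_subsingleton.1 hκ
    let _ : Unique {i // i ∈ componentX E e} :=
      uniqueOfSubsingleton ⟨e.1, fst_mem_componentX e⟩
    let _ : Unique {j // j ∈ componentY E e} :=
      uniqueOfSubsingleton ⟨e.2, snd_mem_componentY he⟩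
    refine ⟨1, zero_le_one, fun F hF hF0 => ?_⟩
    have h := fun P hP => isDominated_of_unique
      (F := fun (i : {i // i ∈ componentX E e}) (j : {j // j ∈ componentY E e}) =>
          fillEdges E F i j)
      (fun i j => bddMeasurable_fillEdges hF _ _) (fun i j => fillEdges_nonneg hF0 _ _)
      (c := fun i => i.1 ∈ S) (c' := fun j => j.1 ∈ T) hST'
      (θ := fun i j => exponent E i j) (fun i j => exponent_nonneg E _ _)
      (fun i j => by simpa using hθ i i.2 j) (P := P) hP
    exact (h _ fun Q hQ i j => hQ _ _).mono fun Q _ => le_of_eq (by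
      unfold componentAvg
      congr!)

theorem avgMeasure_prod_avgMeasure (Q : DyadicSquare) :
    (avgMeasure Q.k Q.a).prod (avgMeasure Q.k Q.b)
      = (ENNReal.ofReal Q.area)⁻¹ • volume.restrict Q.toSet := by
  have h : (ENNReal.ofReal Q.area)⁻¹ = ENNReal.ofReal (2 ^ Q.k) * ENNReal.ofReal (2 ^ Q.k) := by
    rw [← ENNReal.ofReal_inv_of_pos Q.area_pos, ← ENNReal.ofReal_mul (two_zpow_pos _).le,
      DyadicSquare.area, DyadicSquare.side, zpow_neg, mul_inv, inv_inv]
  rw [avgMeasure, avgMeasure, Measure.prod_smul_left, Measure.prod_smul_right,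
    Measure.prod_restrict, smul_smul, h]
  rfl

theorem IsAdmissible.bddMeasurable {F : ℝ × ℝ → ℝ} (hF : IsAdmissible F) : BddMeasurable F := by
  obtain ⟨M, hM⟩ := hF.bounded
  exact ⟨hF.measurable, M, fun z => by rw [abs_of_nonneg (hF.nonneg z)]; exact hM z⟩

/-- The power mean of a function that is divided by an upper bound of its power mean. -/
theorem isNormalized_of_powerMean_le {F : ℝ × ℝ → ℝ} (hF : IsAdmissible F) {d : ℕ} (hd : 0 < d)
    {N : ℝ} (hN : 0 < N) {Q : DyadicSquare} (h : powerMean d F Q ≤ ENNReal.ofReal N) :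
    IsNormalized (1 / d) (fun z => N⁻¹ * F z) (avgMeasure Q.k Q.a) (avgMeasure Q.k Q.b) := by
  have hd' : (0 : ℝ) < d := by exact_mod_cast hd
  have hN0 : ENNReal.ofReal N ^ d ≠ 0 := by simp [hN]
  refine ⟨fun z => ENNReal.ofReal (N⁻¹ ^ d * F z ^ d), ?_, fun z => ?_, ?_⟩
  · exact ((hF.measurable.pow_const d).const_mul _).ennreal_ofReal
  · simp only
    rw [← mul_pow, ENNReal.ofReal_pow (mul_nonneg (inv_nonneg.2 hN.le) (hF.nonneg z)),
      ← ENNReal.rpow_natCast, ← ENNReal.rpow_mul, mul_one_div_cancel hd'.ne', ENNReal.rpow_one]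
  · have h1 : ∀ z, ENNReal.ofReal (N⁻¹ ^ d * F z ^ d)
        = (ENNReal.ofReal N ^ d)⁻¹ * ENNReal.ofReal (F z ^ d) := fun z => by
      rw [ENNReal.ofReal_mul (by positivity), inv_pow, ENNReal.ofReal_inv_of_pos (by positivity),
        ENNReal.ofReal_pow hN.le]
    simp_rw [h1]
    rw [lintegral_const_mul _ (hF.measurable.pow_const d).ennreal_ofReal,
      avgMeasure_prod_avgMeasure, lintegral_smul_measure, smul_eq_mul]
    refine (mul_le_mul_right ?_ _).trans (ENNReal.inv_mul_le_one _)
    have h2 := ENNReal.rpow_le_rpow h hd'.le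
    rwa [powerMean, ← ENNReal.rpow_mul, one_div_mul_cancel hd'.ne', ENNReal.rpow_one,
      ENNReal.rpow_natCast] at h2

theorem paraproductTerm_const_mul (E : Finset (Fin m × Fin n)) (S : Finset (Fin m))
    (T : Finset (Fin n)) (N : Fin m × Fin n → ℝ) (F : Fin m × Fin n → ℝ × ℝ → ℝ)
    (Q : DyadicSquare) :
    paraproductTerm E S T (fun e z => N e * F e z) Q
      = (∏ e ∈ E, N e) * paraproductTerm E S T F Q := by
  unfold paraproductTerm
  simp_rw [Finset.prod_mul_distrib, mul_assoc]
  rw [integral_const_mul, mul_left_comm]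

theorem maxPowerMean_ne_top {F : ℝ × ℝ → ℝ} (hF : IsAdmissible F) {d : ℕ} (hd : 0 < d)
    (𝒯 : FiniteConvexTree) : maxPowerMean d F 𝒯 ≠ ∞ := by
  obtain ⟨M, hM⟩ := hF.bounded
  have hd' : (0 : ℝ) < d := by exact_mod_cast hd
  refine ne_top_of_le_ne_top (b := ENNReal.ofReal M) ENNReal.ofReal_ne_top
    (iSup₂_le fun Q _ => ?_)
  have h : ∫⁻ z, ENNReal.ofReal (F z ^ d) ∂(avgMeasure Q.k Q.a).prod (avgMeasure Q.k Q.b)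
      ≤ ENNReal.ofReal M ^ d := by
    calc ∫⁻ z, ENNReal.ofReal (F z ^ d) ∂(avgMeasure Q.k Q.a).prod (avgMeasure Q.k Q.b)
        ≤ ∫⁻ z, ENNReal.ofReal M ^ d ∂(avgMeasure Q.k Q.a).prod (avgMeasure Q.k Q.b) := by
          refine lintegral_mono fun z => ?_
          rw [ENNReal.ofReal_pow (hF.nonneg z)]
          exact pow_le_pow_left' (ENNReal.ofReal_le_ofReal (hM z)) d
      _ = ENNReal.ofReal M ^ d := by simp
  rw [avgMeasure_prod_avgMeasure, lintegral_smul_measure] at h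
  refine (ENNReal.rpow_le_rpow h (by positivity)).trans (le_of_eq ?_)
  rw [← ENNReal.rpow_natCast, ← ENNReal.rpow_mul, mul_one_div_cancel hd'.ne', ENNReal.rpow_one]

/-- The square function estimate. -/
theorem exists_sum_area_mul_sq_le (E : Finset (Fin m × Fin n)) (S : Finset (Fin m))
    (T : Finset (Fin n)) (hST : S.Nonempty ∨ T.Nonempty) (hnc : IsNonCancellative E S T) :
    ∃ K : ℝ, 0 ≤ K ∧ ∀ (𝒯 : FiniteConvexTree) (F : Fin m × Fin n → ℝ × ℝ → ℝ),
      (∀ e ∈ E, IsAdmissible (F e)) →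
      √(∑ Q ∈ 𝒯.squares, Q.area * paraproductTerm E S T F Q ^ 2)
        ≤ √(K * 𝒯.top.area) * ∏ e ∈ E, (maxPowerMean (threshold E e) (F e) 𝒯).toReal := by
  obtain ⟨K, hK0, hK⟩ := exists_isDominated E S T hST hnc
  refine ⟨K, hK0, fun 𝒯 F hF => ?_⟩
  set N : Fin m × Fin n → ℝ := fun e => (maxPowerMean (threshold E e) (F e) 𝒯).toReal
  -- divide by `N e + ε`, so that the normalizing factors are positive
  have hε : ∀ ε > 0, √(∑ Q ∈ 𝒯.squares, Q.area * paraproductTerm E S T F Q ^ 2)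
      ≤ √(K * 𝒯.top.area) * ∏ e ∈ E, (N e + ε) := by
    intro ε hε
    have hN : ∀ e, 0 < N e + ε := fun e => add_pos_of_nonneg_of_pos ENNReal.toReal_nonneg hε
    have hprod : 0 < ∏ e ∈ E, (N e + ε) := Finset.prod_pos fun e _ => hN e
    have h := (hK (fun e z => (N e + ε)⁻¹ * F e z)
      (fun e he => (hF e he).bddMeasurable.const_mul _)
      (fun e he z => mul_nonneg (inv_nonneg.2 (hN e).le) ((hF e he).nonneg z))).sum_le 𝒯 ?_
    · simp_rw [paraproductTerm_const_mul, mul_pow, mul_left_comm _ (_ ^ 2) (_ ^ 2),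
        ← Finset.mul_sum] at h
      rw [Finset.prod_inv_distrib, inv_pow, ← div_eq_inv_mul, div_le_iff₀ (by positivity)] at h
      refine (Real.sqrt_le_sqrt h).trans (le_of_eq ?_)
      rw [Real.sqrt_mul' _ (sq_nonneg _), Real.sqrt_sq hprod.le]
    · intro Q hQ i j
      unfold exponent fillEdges
      by_cases he : (i, j) ∈ E
      · simp only [he, if_true]
        refine isNormalized_of_powerMean_le (hF _ he) (threshold_pos E _) (hN _) ?_
        refine (le_iSup₂ (f := fun (Q : DyadicSquare)
          (_ : Q ∈ {Q | Q ∈ 𝒯.squares ∨ Q ∈ 𝒯.leaves}) =>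
            powerMean (threshold E (i, j)) (F (i, j)) Q) Q hQ).trans ?_
        change maxPowerMean (threshold E (i, j)) (F (i, j)) 𝒯 ≤ _
        rw [← ENNReal.ofReal_toReal (maxPowerMean_ne_top (hF _ he) (threshold_pos E _) 𝒯)]
        exact ENNReal.ofReal_le_ofReal (le_add_of_nonneg_right hε.le)
      · simp only [he, if_false]
        exact isNormalized_one _ _ _
  have hcont : Filter.Tendsto (fun ε : ℝ => √(K * 𝒯.top.area) * ∏ e ∈ E, (N e + ε))
      (nhdsWithin 0 (Set.Ioi 0)) (nhds (√(K * 𝒯.top.area) * ∏ e ∈ E, (N e + 0))) := by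
    refine Filter.Tendsto.mono_left (Continuous.tendsto ?_ 0) nhdsWithin_le_nhds
    fun_prop
  simp only [add_zero] at hcont
  exact ge_of_tendsto hcont (eventually_nhdsWithin_of_forall fun ε h => hε ε h)

end SquareFunction

/-! ### Estimate of the localized form -/

theorem ofReal_sqrt (x : ℝ) : ENNReal.ofReal √x = ENNReal.ofReal x ^ (1 / 2 : ℝ) := by
  rcases le_total 0 x with h | h
  · rw [Real.sqrt_eq_rpow, ENNReal.ofReal_rpow_of_nonneg h (by norm_num)]
  · rw [Real.sqrt_eq_zero_of_nonpos h, ENNReal.ofReal_of_nonpos h]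
    simp

theorem ofReal_sqrt_sum_le_bmoNorm (lam : DyadicSquare → ℂ) (𝒯 : FiniteConvexTree) :
    ENNReal.ofReal √(∑ Q ∈ 𝒯.squares, Q.area * ‖lam Q‖ ^ 2)
      ≤ ENNReal.ofReal √𝒯.top.area * bmoNorm lam := by
  have h0 : ENNReal.ofReal 𝒯.top.area ≠ 0 := by simpa using 𝒯.top.area_pos
  set t : ℝ≥0∞ := ∑' Q : {Q : DyadicSquare // Q.toSet ⊆ 𝒯.top.toSet},
    ENNReal.ofReal Q.1.area * ‖lam Q.1‖ₑ ^ 2 with ht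
  have h1 : ENNReal.ofReal (∑ Q ∈ 𝒯.squares, Q.area * ‖lam Q‖ ^ 2) ≤ t := by
    have hinj : Function.Injective fun Q : 𝒯.squares =>
        (⟨Q.1, 𝒯.subset_top Q.1 Q.2⟩ : {Q : DyadicSquare // Q.toSet ⊆ 𝒯.top.toSet}) :=
      fun Q Q' h => Subtype.ext (congrArg (fun Q => Q.1) h)
    refine le_trans (le_of_eq ?_) (ENNReal.tsum_comp_le_tsum_of_injective hinj _)
    rw [ENNReal.ofReal_sum_of_nonneg fun Q _ => mul_nonneg Q.area_pos.le (sq_nonneg _),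
      tsum_fintype, ← Finset.sum_coe_sort]
    refine Finset.sum_congr rfl fun Q _ => ?_
    rw [ENNReal.ofReal_mul Q.1.area_pos.le, ENNReal.ofReal_pow (norm_nonneg _), ofReal_norm]
  have h2 : ((ENNReal.ofReal 𝒯.top.area)⁻¹ * t) ^ (1 / 2 : ℝ) ≤ bmoNorm lam :=
    le_iSup (fun Q₀ : DyadicSquare => ((ENNReal.ofReal Q₀.area)⁻¹ *
      ∑' Q : {Q : DyadicSquare // Q.toSet ⊆ Q₀.toSet},
        ENNReal.ofReal Q.1.area * ‖lam Q.1‖ₑ ^ 2) ^ (1 / 2 : ℝ)) 𝒯.top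
  rw [ofReal_sqrt, ofReal_sqrt]
  refine le_trans (ENNReal.rpow_le_rpow h1 (by norm_num)) ?_
  refine le_trans (le_of_eq ?_) (mul_le_mul_right h2 _)
  rw [← ENNReal.mul_rpow_of_nonneg _ _ (by norm_num), ← mul_assoc,
    ENNReal.mul_inv_cancel h0 ENNReal.ofReal_ne_top, one_mul]

theorem exists_localizedForm_le {m n : ℕ} (E : Finset (Fin m × Fin n)) (S : Finset (Fin m))
    (T : Finset (Fin n)) (hST : S.Nonempty ∨ T.Nonempty) (hnc : IsNonCancellative E S T) :
    ∃ C : ℝ, ∀ (lam : DyadicSquare → ℂ) (𝒯 : FiniteConvexTree) (F : Fin m × Fin n → ℝ × ℝ → ℝ),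
      (∀ e ∈ E, IsAdmissible (F e)) →
      ENNReal.ofReal (localizedForm E S T lam 𝒯 F) ≤
        ENNReal.ofReal C * bmoNorm lam * ENNReal.ofReal 𝒯.top.area *
          ∏ e ∈ E, maxPowerMean (threshold E e) (F e) 𝒯 := by
  obtain ⟨K, hK0, hK⟩ := exists_sum_area_mul_sq_le E S T hST hnc
  refine ⟨√K, fun lam 𝒯 F hF => ?_⟩
  have hcs : localizedForm E S T lam 𝒯 F ≤ √(∑ Q ∈ 𝒯.squares, Q.area * ‖lam Q‖ ^ 2)
      * √(∑ Q ∈ 𝒯.squares, Q.area * paraproductTerm E S T F Q ^ 2) := by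
    refine le_trans (le_of_eq ?_) (Real.sum_mul_le_sqrt_mul_sqrt 𝒯.squares
      (fun Q => √Q.area * ‖lam Q‖) fun Q => √Q.area * |paraproductTerm E S T F Q|) |>.trans
      (le_of_eq ?_)
    · refine Finset.sum_congr rfl fun Q _ => ?_
      rw [mul_mul_mul_comm, Real.mul_self_sqrt Q.area_pos.le]
      ring
    · simp_rw [mul_pow, sq_abs, Real.sq_sqrt (DyadicSquare.area_pos _).le]
  have hprod : ENNReal.ofReal (∏ e ∈ E, (maxPowerMean (threshold E e) (F e) 𝒯).toReal)
      = ∏ e ∈ E, maxPowerMean (threshold E e) (F e) 𝒯 := by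
    rw [ENNReal.ofReal_prod_of_nonneg fun e _ => ENNReal.toReal_nonneg]
    exact Finset.prod_congr rfl fun e he =>
      ENNReal.ofReal_toReal (maxPowerMean_ne_top (hF e he) (threshold_pos E e) 𝒯)
  refine (ENNReal.ofReal_le_ofReal hcs).trans ?_
  rw [ENNReal.ofReal_mul (Real.sqrt_nonneg _)]
  refine (mul_le_mul' (ofReal_sqrt_sum_le_bmoNorm lam 𝒯)
    (ENNReal.ofReal_le_ofReal (hK 𝒯 F hF))).trans (le_of_eq ?_)
  have ha : ENNReal.ofReal 𝒯.top.area
      = ENNReal.ofReal √𝒯.top.area * ENNReal.ofReal √𝒯.top.area := by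
    rw [← ENNReal.ofReal_mul (Real.sqrt_nonneg _), Real.mul_self_sqrt 𝒯.top.area_pos.le]
  rw [ENNReal.ofReal_mul (Real.sqrt_nonneg _), hprod, Real.sqrt_mul hK0,
    ENNReal.ofReal_mul (Real.sqrt_nonneg _), ha]
  ring

/-! ### Tensor products of Haar and characteristic functions -/

theorem haarOrChar_mul_self (c : Prop) [Decidable c] (k l : ℤ) (t : ℝ) :
    haarOrChar c k l t * haarOrChar c k l t = charFn k l t := by
  unfold haarOrChar
  split_ifs
  · exact haar_mul_self k l t
  · by_cases h : t ∈ dyadicInterval k l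
    · simp [charFn_of_mem h]
    · simp [charFn_of_notMem h]

theorem integrable_charFn (k l : ℤ) : Integrable (charFn k l) :=
  (integrable_indicator_iff (measurableSet_dyadicInterval k l)).2
    (integrableOn_const (by rw [volume_dyadicInterval]; exact ENNReal.ofReal_ne_top) (by simp))

theorem integral_charFn (k l : ℤ) : ∫ t, charFn k l t = 2 ^ (-k) := by
  have h : charFn k l = (dyadicInterval k l).indicator 1 := rfl
  rw [h, integral_indicator_one (measurableSet_dyadicInterval k l), measureReal_def,
    volume_dyadicInterval, ENNReal.toReal_ofReal (two_zpow_pos _).le]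

theorem integral_haar (k l : ℤ) : ∫ t, haar k l t = 0 := by
  have h := integral_sub (integrable_charFn (k + 1) (2 * l)) (integrable_charFn (k + 1) (2 * l + 1))
  rw [integral_charFn, integral_charFn, sub_self] at h
  exact h

theorem integrable_haarOrChar (c : Prop) [Decidable c] (k l : ℤ) :
    Integrable (haarOrChar c k l) := by
  unfold haarOrChar
  split_ifs
  exacts [(integrable_charFn _ _).sub (integrable_charFn _ _), integrable_charFn k l]

theorem mem_dyadicInterval_iff {j k l l' : ℤ} (hj : j ≤ k) {t t' : ℝ}
    (ht : t ∈ dyadicInterval k l) (ht' : t' ∈ dyadicInterval k l) :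
    t ∈ dyadicInterval j l' ↔ t' ∈ dyadicInterval j l' :=
  ⟨fun h => dyadicInterval_subset_of_mem hj ht h ht',
    fun h => dyadicInterval_subset_of_mem hj ht' h ht⟩

theorem haarOrChar_eq_of_mem {c : Prop} [Decidable c] {k k' l l' : ℤ} (hk : k < k') {t t' : ℝ}
    (ht : t ∈ dyadicInterval k' l') (ht' : t' ∈ dyadicInterval k' l') :
    haarOrChar c k l t = haarOrChar c k l t' := by
  classical
  unfold haarOrChar
  split_ifs
  · simp only [haar, Set.indicator_apply, Pi.one_apply,
      mem_dyadicInterval_iff (show k + 1 ≤ k' by omega) ht ht']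
  · simp only [charFn, Set.indicator_apply, Pi.one_apply, mem_dyadicInterval_iff hk.le ht ht']

theorem integral_haarOrChar_mul_haar {c : Prop} [Decidable c] {k k' l l' : ℤ} (hk : k < k') :
    ∫ t, haarOrChar c k l t * haar k' l' t = 0 := by
  obtain ⟨t₀, ht₀⟩ := dyadicInterval_nonempty k' l'
  have h : ∀ t, haarOrChar c k l t * haar k' l' t = haarOrChar c k l t₀ * haar k' l' t := by
    intro t
    by_cases ht : t ∈ dyadicInterval k' l'
    · rw [haarOrChar_eq_of_mem hk ht ht₀]
    · simp [haar_of_notMem ht]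
  simp_rw [h]
  rw [integral_const_mul, integral_haar, mul_zero]

/-- The function `aI ⊗ bJ` on `Q = I × J`, where `aI` is the Haar function if `c` holds, `bJ` is
the Haar function if `c'` holds, and otherwise these are characteristic functions. -/
def squareHaar (c c' : Prop) [Decidable c] [Decidable c'] (Q : DyadicSquare) (z : ℝ × ℝ) : ℝ :=
  haarOrChar c Q.k Q.a z.1 * haarOrChar c' Q.k Q.b z.2

section SquareHaar

variable (c c' : Prop) [Decidable c] [Decidable c']

theorem bddMeasurable_squareHaar (Q : DyadicSquare) : BddMeasurable (squareHaar c c' Q) :=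
  ((bddMeasurable_haarOrChar c _ _).comp measurable_fst).mul
    ((bddMeasurable_haarOrChar c' _ _).comp measurable_snd)

variable {c c'}

theorem squareHaar_of_notMem {Q : DyadicSquare} {z : ℝ × ℝ} (hz : z ∉ Q.toSet) :
    squareHaar c c' Q z = 0 := by
  rw [DyadicSquare.toSet, Set.mem_prod, not_and_or] at hz
  rcases hz with h | h
  · rw [squareHaar, haarOrChar_of_notMem h, zero_mul]
  · rw [squareHaar, haarOrChar_of_notMem h, mul_zero]

theorem integral_squareHaar (hc : c ∨ c') (Q : DyadicSquare) : ∫ z, squareHaar c c' Q z = 0 := by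
  unfold squareHaar
  rw [Measure.volume_eq_prod,
    integral_prod_mul (haarOrChar c Q.k Q.a) (haarOrChar c' Q.k Q.b)]
  rcases hc with h | h
  · simp [haarOrChar, h, integral_haar]
  · simp [haarOrChar, h, integral_haar]

theorem integral_squareHaar_mul_self (Q : DyadicSquare) :
    ∫ z, squareHaar c c' Q z * squareHaar c c' Q z = Q.area := by
  unfold squareHaar
  simp_rw [mul_mul_mul_comm, haarOrChar_mul_self]
  rw [Measure.volume_eq_prod, integral_prod_mul (charFn Q.k Q.a) (charFn Q.k Q.b),
    integral_charFn, integral_charFn]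
  rfl

theorem integral_squareHaar_mul (hc : c ∨ c') {Q Q' : DyadicSquare} (h : Q ≠ Q') :
    ∫ z, squareHaar c c' Q z * squareHaar c c' Q' z = 0 := by
  wlog hk : Q.k ≤ Q'.k generalizing Q Q'
  · simp_rw [mul_comm (squareHaar c c' Q _)]
    exact this h.symm (by omega)
  rcases hk.lt_or_eq with hk | hk
  · unfold squareHaar
    simp_rw [mul_mul_mul_comm]
    rw [Measure.volume_eq_prod,
      integral_prod_mul (fun t => haarOrChar c Q.k Q.a t * haarOrChar c Q'.k Q'.a t)
        fun t => haarOrChar c' Q.k Q.b t * haarOrChar c' Q'.k Q'.b t]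
    rcases hc with h | h
    · have : haarOrChar c Q'.k Q'.a = haar Q'.k Q'.a := if_pos h
      rw [this, integral_haarOrChar_mul_haar hk, zero_mul]
    · have : haarOrChar c' Q'.k Q'.b = haar Q'.k Q'.b := if_pos h
      rw [this, integral_haarOrChar_mul_haar hk, mul_zero]
  · refine integral_eq_zero_of_ae (.of_forall fun z => ?_)
    by_cases hz : z ∈ Q.toSet
    · have hz' : z ∉ Q'.toSet := fun hz' => h (DyadicSquare.eq_of_mem hk.symm hz hz')
      simp [squareHaar_of_notMem hz']
    · simp [squareHaar_of_notMem hz]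

/-- Bessel's inequality for the functions `squareHaar`, on a dyadic square. -/
theorem sum_norm_integral_sq_le (hc : c ∨ c') (Q₀ : DyadicSquare) {g : ℝ × ℝ → ℂ}
    (hg : MemLp g 2 (volume.restrict Q₀.toSet)) (s : Finset {Q : DyadicSquare // Q.toSet ⊆ Q₀.toSet}) :
    ∑ Q ∈ s, ENNReal.ofReal (Q.1.area)⁻¹ * ‖∫ z in Q₀.toSet, (squareHaar c c' Q.1 z : ℂ) * g z‖ₑ ^ 2
      ≤ ∫⁻ z in Q₀.toSet, ‖g z‖ₑ ^ 2 := by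
  classical
  set μ := volume.restrict Q₀.toSet
  have hfin : IsFiniteMeasure μ := ⟨by
    rw [Measure.restrict_apply_univ, DyadicSquare.toSet, Measure.volume_eq_prod, Measure.prod_prod,
      volume_dyadicInterval, volume_dyadicInterval]
    exact ENNReal.mul_lt_top ENNReal.ofReal_lt_top ENNReal.ofReal_lt_top⟩
  set e : DyadicSquare → ℝ × ℝ → ℂ := fun Q z => ((Q.side⁻¹ * squareHaar c c' Q z : ℝ) : ℂ)
  have he : ∀ Q, MemLp (e Q) 2 μ := by
    intro Q
    have h := (bddMeasurable_squareHaar c c' Q).const_mul Q.side⁻¹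
    obtain ⟨M, hM⟩ := h.bounded
    refine MemLp.of_bound (Complex.measurable_ofReal.comp h.measurable).aestronglyMeasurable M
      (.of_forall fun z => ?_)
    rw [Complex.norm_real]
    exact hM z
  have hset : ∀ (Q : {Q : DyadicSquare // Q.toSet ⊆ Q₀.toSet}) (f : ℝ × ℝ → ℝ),
      ∫ z, squareHaar c c' Q.1 z * f z ∂μ = ∫ z, squareHaar c c' Q.1 z * f z := by
    intro Q f
    refine setIntegral_eq_integral_of_forall_compl_eq_zero fun z hz => ?_
    rw [squareHaar_of_notMem fun h => hz (Q.2 h), zero_mul]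
  have hinner : ∀ Q (f : ℝ × ℝ → ℂ) (hf : MemLp f 2 μ),
      inner ℂ ((he Q).toLp (e Q)) (hf.toLp f)
        = (Q.side : ℂ)⁻¹ * ∫ z, (squareHaar c c' Q z : ℂ) * f z ∂μ := by
    intro Q f hf
    rw [L2.inner_def, ← integral_const_mul]
    refine integral_congr_ae ?_
    filter_upwards [(he Q).coeFn_toLp, hf.coeFn_toLp] with z h1 h2
    rw [h1, h2, RCLike.inner_apply]
    simp only [e, Complex.conj_ofReal]
    push_cast
    ring
  have hon : Orthonormal ℂ fun Q : {Q : DyadicSquare // Q.toSet ⊆ Q₀.toSet} =>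
      (he Q.1).toLp (e Q.1) := by
    rw [orthonormal_iff_ite]
    intro Q Q'
    have h1 : ∫ z, (squareHaar c c' Q.1 z : ℂ) * e Q'.1 z ∂μ
        = ((Q'.1.side⁻¹ * ∫ z, squareHaar c c' Q.1 z * squareHaar c c' Q'.1 z : ℝ) : ℂ) := by
      rw [← hset, ← integral_const_mul, ← integral_complex_ofReal]
      refine integral_congr_ae (.of_forall fun z => ?_)
      simp only [e]
      push_cast
      ring
    rw [hinner, h1]
    split_ifs with h
    · subst h
      rw [integral_squareHaar_mul_self, DyadicSquare.area]
      have : (Q.1.side : ℂ) ≠ 0 := by exact_mod_cast Q.1.side_pos.ne'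
      push_cast
      field_simp
    · rw [integral_squareHaar_mul hc fun h' => h (Subtype.ext h')]
      simp
  have hb := hon.sum_inner_products_le (hg.toLp g) (s := s)
  have hn : ENNReal.ofReal (‖hg.toLp g‖ ^ 2) = ∫⁻ z, ‖g z‖ₑ ^ 2 ∂μ := by
    rw [Lp.norm_toLp, ENNReal.ofReal_pow ENNReal.toReal_nonneg, ENNReal.ofReal_toReal hg.2.ne,
      eLpNorm_eq_lintegral_rpow_enorm_toReal two_ne_zero ENNReal.ofNat_ne_top,
      ← ENNReal.rpow_natCast, ← ENNReal.rpow_mul]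
    norm_num
  rw [← hn]
  refine le_trans (le_of_eq ?_) (ENNReal.ofReal_le_ofReal hb)
  rw [ENNReal.ofReal_sum_of_nonneg fun Q _ => sq_nonneg _]
  refine Finset.sum_congr rfl fun Q _ => ?_
  rw [hinner, ← ofReal_norm, ← ENNReal.ofReal_pow (norm_nonneg _),
    ← ENNReal.ofReal_mul (inv_nonneg.2 Q.1.area_pos.le), norm_mul, mul_pow, norm_inv,
    Complex.norm_real, Real.norm_eq_abs, inv_pow, sq_abs, DyadicSquare.area, sq Q.1.side]

end SquareHaar

/-! ### Separating one pair of variables -/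

theorem measurePreserving_glue {m : ℕ} (u : Fin m) :
    MeasurePreserving (fun p : ℝ × ({i : Fin m // i ≠ u} → ℝ) => glue u p.1 p.2) := by
  have hmeas : Measurable fun p : ℝ × ({i : Fin m // i ≠ u} → ℝ) => glue u p.1 p.2 := by
    refine measurable_pi_iff.2 fun i => ?_
    unfold glue
    split_ifs with h
    · exact measurable_fst
    · exact (measurable_pi_apply _).comp measurable_snd
  refine ⟨hmeas, (Measure.pi_eq fun s hs => ?_).symm⟩
  rw [Measure.map_apply hmeas (MeasurableSet.univ_pi hs)]
  have h : (fun p : ℝ × ({i : Fin m // i ≠ u} → ℝ) => glue u p.1 p.2) ⁻¹' Set.univ.pi s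
      = s u ×ˢ Set.univ.pi fun i : {i : Fin m // i ≠ u} => s i := by
    ext p
    simp only [Set.mem_preimage, Set.mem_univ_pi, Set.mem_prod]
    constructor
    · refine fun h => ⟨by simpa [glue] using h u, fun i => by simpa [glue, i.2] using h i⟩
    · rintro ⟨h1, h2⟩ i
      unfold glue
      split_ifs with hi
      · exact hi ▸ h1
      · exact h2 ⟨i, hi⟩
  rw [h, Measure.volume_eq_prod, Measure.prod_prod, volume_pi_pi,
    Fintype.prod_eq_mul_prod_subtype_ne _ u]

/-! ### Coefficients of a perfect kernel -/

theorem measurePreserving_prodProdProdComm {α β γ δ : Type*} [MeasurableSpace α]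
    [MeasurableSpace β] [MeasurableSpace γ] [MeasurableSpace δ] (μa : Measure α) (μb : Measure β)
    (μc : Measure γ) (μd : Measure δ) [SFinite μa] [SFinite μb] [SFinite μc] [SFinite μd] :
    MeasurePreserving (fun p : (α × β) × (γ × δ) => ((p.1.1, p.2.1), (p.1.2, p.2.2)))
      ((μa.prod μb).prod (μc.prod μd)) ((μa.prod μc).prod (μb.prod μd)) := by
  have h1 := measurePreserving_prodAssoc μa μb (μc.prod μd)
  have h2 := (measurePreserving_prodAssoc μb μc μd).symm
  have h3 := (Measure.measurePreserving_swap (μ := μb) (ν := μc)).prod (MeasurePreserving.id μd)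
  have h4 := measurePreserving_prodAssoc μc μb μd
  have h5 := (measurePreserving_prodAssoc μa μc (μb.prod μd)).symm
  exact h5.comp (((MeasurePreserving.id μa).prod (h4.comp (h3.comp h2))).comp h1)

/-- The point of `ℝᵐ × ℝⁿ` with distinguished coordinates `z` and remaining coordinates `w`. -/
def gluePair {m n : ℕ} (e : Fin m × Fin n)
    (q : (ℝ × ℝ) × (({i : Fin m // i ≠ e.1} → ℝ) × ({j : Fin n // j ≠ e.2} → ℝ))) :
    (Fin m → ℝ) × (Fin n → ℝ) :=
  (glue e.1 q.1.1 q.2.1, glue e.2 q.1.2 q.2.2)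

theorem measurePreserving_gluePair {m n : ℕ} (e : Fin m × Fin n) :
    MeasurePreserving (gluePair e) :=
  ((measurePreserving_glue e.1).prod (measurePreserving_glue e.2)).comp
    (measurePreserving_prodProdProdComm volume volume volume volume)

section Kernel

variable {m n : ℕ} {K : (Fin m → ℝ) × (Fin n → ℝ) → ℂ}

theorem IsPerfectDyadicCZKernel.integrable (hK : IsPerfectDyadicCZKernel K) : Integrable K :=
  (integrableOn_iff_integrable_of_support_subset (subset_tsupport K)).1
    (hK.locallyIntegrable.integrableOn_isCompact hK.hasCompactSupport)

theorem IsPerfectDyadicCZKernel.integrable_comp (hK : IsPerfectDyadicCZKernel K)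
    (e : Fin m × Fin n) : Integrable (fun q => K (gluePair e q)) := by
  have h := (measurePreserving_gluePair e).integrable_comp (g := K) hK.integrable.1
  exact h.2 hK.integrable

theorem adjointOp_one (E : Finset (Fin m × Fin n)) (K : (Fin m → ℝ) × (Fin n → ℝ) → ℂ)
    (e : Fin m × Fin n) (z : ℝ × ℝ) :
    adjointOp E K e (fun _ _ => 1) z = ∫ w, K (gluePair e (z, w)) := by
  simp [adjointOp, gluePair]

theorem IsPerfectDyadicCZKernel.integrable_adjointOp_one (hK : IsPerfectDyadicCZKernel K)
    (E : Finset (Fin m × Fin n)) (e : Fin m × Fin n) :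
    Integrable (adjointOp E K e fun _ _ => 1) := by
  have h : adjointOp E K e (fun _ _ => 1) = fun z => ∫ w, K (gluePair e (z, w)) :=
    funext (adjointOp_one E K e)
  rw [h]
  exact Integrable.integral_prod_left (μ := volume) (ν := volume) (hK.integrable_comp e)

/-- If one of the remaining coordinates lies outside of the sides of `Q`, then a perfect kernel does
not depend on the distinguished coordinates within `Q`. -/
theorem IsPerfectDyadicCZKernel.eq_of_mem (hK : IsPerfectDyadicCZKernel K) (e : Fin m × Fin n)
    {Q : DyadicSquare} {w : ({i : Fin m // i ≠ e.1} → ℝ) × ({j : Fin n // j ≠ e.2} → ℝ)}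
    (hw : (∃ i, w.1 i ∉ dyadicInterval Q.k Q.a) ∨ ∃ j, w.2 j ∉ dyadicInterval Q.k Q.b)
    {z z' : ℝ × ℝ} (hz : z ∈ Q.toSet) (hz' : z' ∈ Q.toSet) :
    K (gluePair e (z, w)) = K (gluePair e (z', w)) := by
  have hmem : ∀ {N : ℕ} (u : Fin N) (x : {i : Fin N // i ≠ u} → ℝ) (k a : ℤ) {t t' : ℝ},
      t ∈ dyadicInterval k a → t' ∈ dyadicInterval k a →
      ∀ i, glue u t' x i ∈ dyadicInterval k ⌊(2 : ℝ) ^ k * glue u t x i⌋ := by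
    intro N u x k a t t' ht ht' i
    rw [mem_dyadicInterval] at *
    unfold glue
    split_ifs
    · rw [ht, ht']
    · rfl
  refine hK.perfect Q.k (fun i => ⌊(2 : ℝ) ^ Q.k * glue e.1 z.1 w.1 i⌋)
    (fun j => ⌊(2 : ℝ) ^ Q.k * glue e.2 z.2 w.2 j⌋) ?_ _
    ⟨hmem e.1 w.1 Q.k Q.a hz.1 hz.1, hmem e.2 w.2 Q.k Q.b hz.2 hz.2⟩ _
    ⟨hmem e.1 w.1 Q.k Q.a hz.1 hz'.1, hmem e.2 w.2 Q.k Q.b hz.2 hz'.2⟩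
  rw [Set.disjoint_left]
  rintro _ ⟨h1, h2⟩ ⟨x, y, rfl⟩
  simp only [mem_dyadicInterval] at h1 h2
  rcases hw with ⟨i, hi⟩ | ⟨j, hj⟩
  · refine hi (mem_dyadicInterval.2 ?_)
    have h3 := (h1 i.1).symm.trans (h1 e.1)
    simp only [glue, i.2, dif_neg, not_false_iff, dif_pos] at h3
    exact h3.trans (mem_dyadicInterval.1 hz.1)
  · refine hj (mem_dyadicInterval.2 ?_)
    have h3 := (h2 j.1).symm.trans (h2 e.2)
    simp only [glue, j.2, dif_neg, not_false_iff, dif_pos] at h3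
    exact h3.trans (mem_dyadicInterval.1 hz.2)

/-- The product of the characteristic functions of the sides of `Q` in the remaining variables. -/
def restChar (e : Fin m × Fin n) (Q : DyadicSquare)
    (w : ({i : Fin m // i ≠ e.1} → ℝ) × ({j : Fin n // j ≠ e.2} → ℝ)) : ℝ :=
  (∏ i, charFn Q.k Q.a (w.1 i)) * ∏ j, charFn Q.k Q.b (w.2 j)

theorem restChar_eq_one {e : Fin m × Fin n} {Q : DyadicSquare}
    {w : ({i : Fin m // i ≠ e.1} → ℝ) × ({j : Fin n // j ≠ e.2} → ℝ)}
    (h1 : ∀ i, w.1 i ∈ dyadicInterval Q.k Q.a) (h2 : ∀ j, w.2 j ∈ dyadicInterval Q.k Q.b) :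
    restChar e Q w = 1 := by
  simp [restChar, charFn, h1, h2]

theorem tensor_gluePair {S : Finset (Fin m)} {T : Finset (Fin n)} {e : Fin m × Fin n}
    (hS : ∀ i ∈ S, i = e.1) (hT : ∀ j ∈ T, j = e.2) (Q : DyadicSquare)
    (q : (ℝ × ℝ) × (({i : Fin m // i ≠ e.1} → ℝ) × ({j : Fin n // j ≠ e.2} → ℝ))) :
    tensor S T Q (gluePair e q)
      = squareHaar (e.1 ∈ S) (e.2 ∈ T) Q q.1 * restChar e Q q.2 := by
  have h : ∀ {N : ℕ} (U : Finset (Fin N)) (u : Fin N) (_ : ∀ i ∈ U, i = u) (k a : ℤ) (t : ℝ)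
      (x : {i : Fin N // i ≠ u} → ℝ),
      ∏ i, (if i ∈ U then haar k a (glue u t x i) else charFn k a (glue u t x i))
        = haarOrChar (u ∈ U) k a t * ∏ i, charFn k a (x i) := by
    intro N U u hU k a t x
    rw [Fintype.prod_eq_mul_prod_subtype_ne _ u]
    congr 1
    · unfold haarOrChar
      split_ifs <;> simp [glue]
    · refine Finset.prod_congr rfl fun i _ => ?_
      rw [if_neg fun hi => i.2 (hU _ hi)]
      simp [glue, i.2]
  simp only [tensor, gluePair]
  rw [h S e.1 hS, h T e.2 hT, squareHaar, restChar]
  ring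

theorem bddMeasurable_restChar (e : Fin m × Fin n) (Q : DyadicSquare) :
    BddMeasurable (restChar e Q) :=
  (BddMeasurable.finset_prod fun i _ => (bddMeasurable_charFn Q.k Q.a).comp
    (φ := fun w : ({i : Fin m // i ≠ e.1} → ℝ) × ({j : Fin n // j ≠ e.2} → ℝ) => w.1 i)
      (by fun_prop)).mul
    (BddMeasurable.finset_prod fun j _ => (bddMeasurable_charFn Q.k Q.b).comp
    (φ := fun w : ({i : Fin m // i ≠ e.1} → ℝ) × ({j : Fin n // j ≠ e.2} → ℝ) => w.2 j)
      (by fun_prop))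

theorem integrable_mul_bddMeasurable {α : Type*} [MeasurableSpace α] {μ : Measure α} {f : α → ℂ}
    {g : α → ℝ} (hf : Integrable f μ) (hg : BddMeasurable g) :
    Integrable (fun x => f x * (g x : ℂ)) μ := by
  obtain ⟨M, hM⟩ := hg.bounded
  refine hf.mul_bdd (c := M) (Complex.measurable_ofReal.comp hg.measurable).aestronglyMeasurable
    (.of_forall fun x => ?_)
  rw [Complex.norm_real]
  exact hM x

/-- The coefficients of a non-cancellative paraproduct are the Haar-type coefficients of
`T_{u,v}(1, …, 1)`: where some of the remaining variables leave `Q`, the kernel is constant in the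
pair `(x_u, y_v)` on `Q`, so that this part of the integral vanishes. -/
theorem IsPerfectDyadicCZKernel.area_mul_coefficient (hK : IsPerfectDyadicCZKernel K)
    (E : Finset (Fin m × Fin n)) {S : Finset (Fin m)} {T : Finset (Fin n)} {e : Fin m × Fin n}
    (hS : ∀ i ∈ S, i = e.1) (hT : ∀ j ∈ T, j = e.2) (hST : e.1 ∈ S ∨ e.2 ∈ T)
    (Q : DyadicSquare) :
    (Q.area : ℂ) * coefficient K S T Q
      = ∫ z, (squareHaar (e.1 ∈ S) (e.2 ∈ T) Q z : ℂ) * adjointOp E K e (fun _ _ => 1) z := by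
  set h : ℝ × ℝ → ℝ := squareHaar (e.1 ∈ S) (e.2 ∈ T) Q
  set χ := restChar e Q
  have hint := hK.integrable_comp e
  have hh := bddMeasurable_squareHaar (e.1 ∈ S) (e.2 ∈ T) Q
  have hb1 : BddMeasurable fun q : (ℝ × ℝ) ×
      (({i : Fin m // i ≠ e.1} → ℝ) × ({j : Fin n // j ≠ e.2} → ℝ)) => h q.1 * χ q.2 :=
    (hh.comp measurable_fst).mul ((bddMeasurable_restChar e Q).comp measurable_snd)
  have hb2 : BddMeasurable fun q : (ℝ × ℝ) ×
      (({i : Fin m // i ≠ e.1} → ℝ) × ({j : Fin n // j ≠ e.2} → ℝ)) => h q.1 * (1 - χ q.2) :=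
    (hh.comp measurable_fst).mul
      ((BddMeasurable.const 1).sub ((bddMeasurable_restChar e Q).comp measurable_snd))
  have hi1 := integrable_mul_bddMeasurable hint hb1
  have hi2 := integrable_mul_bddMeasurable hint hb2
  have hzero : ∫ q, K (gluePair e q) * ((h q.1 * (1 - χ q.2) : ℝ) : ℂ) = 0 := by
    rw [Measure.volume_eq_prod, integral_prod_symm _ hi2]
    refine integral_eq_zero_of_ae (.of_forall fun w => ?_)
    simp only [Pi.zero_apply]
    by_cases hw : (∀ i, w.1 i ∈ dyadicInterval Q.k Q.a) ∧ ∀ j, w.2 j ∈ dyadicInterval Q.k Q.b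
    · have : χ w = 1 := restChar_eq_one hw.1 hw.2
      simp [this]
    · rw [not_and_or, not_forall, not_forall] at hw
      obtain ⟨z₀, hz₀⟩ := Q.toSet_nonempty
      have hc : ∀ z, K (gluePair e (z, w)) * ((h z * (1 - χ w) : ℝ) : ℂ)
          = K (gluePair e (z₀, w)) * (1 - χ w) * (h z : ℂ) := by
        intro z
        by_cases hz : z ∈ Q.toSet
        · rw [hK.eq_of_mem e hw hz hz₀]
          push_cast
          ring
        · simp [h, squareHaar_of_notMem hz]
      simp_rw [hc]
      rw [integral_const_mul, integral_complex_ofReal, integral_squareHaar hST]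
      simp
  have harea : (Q.area : ℂ) ≠ 0 := by exact_mod_cast Q.area_pos.ne'
  have hmp := measurePreserving_gluePair e
  have htm : AEStronglyMeasurable (fun p => K p * (tensor S T Q p : ℂ)) := by
    refine hK.integrable.1.mul (Complex.measurable_ofReal.comp ?_).aestronglyMeasurable
    unfold tensor
    refine Measurable.mul (Finset.measurable_prod _ fun i _ => ?_)
      (Finset.measurable_prod _ fun j _ => ?_)
    · split_ifs
      · exact (measurable_haar _ _).comp ((measurable_pi_apply i).comp measurable_fst)
      · exact (measurable_charFn _ _).comp ((measurable_pi_apply i).comp measurable_fst)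
    · split_ifs
      · exact (measurable_haar _ _).comp ((measurable_pi_apply j).comp measurable_snd)
      · exact (measurable_charFn _ _).comp ((measurable_pi_apply j).comp measurable_snd)
  rw [coefficient, mul_inv_cancel_left₀ harea, ← hmp.map_eq,
    integral_map hmp.measurable.aemeasurable (by rw [hmp.map_eq]; exact htm)]
  simp_rw [tensor_gluePair hS hT]
  rw [← add_zero (∫ q, K (gluePair e q) * _), ← hzero, ← integral_add hi1 hi2]
  have hsum : ∀ q, K (gluePair e q) * ((h q.1 * χ q.2 : ℝ) : ℂ)
      + K (gluePair e q) * ((h q.1 * (1 - χ q.2) : ℝ) : ℂ)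
      = K (gluePair e q) * (h q.1 : ℂ) := fun q => by
    push_cast
    ring
  simp_rw [hsum]
  rw [Measure.volume_eq_prod, integral_prod _
    (integrable_mul_bddMeasurable hint (hh.comp measurable_fst))]
  refine integral_congr_ae (.of_forall fun z => ?_)
  simp only
  rw [integral_mul_const, adjointOp_one, mul_comm]

/-- The coefficients are bounded in `bmo` by the `BMO` seminorm of `T_{u,v}(1, …, 1)`, which is
Bessel's inequality on each dyadic square. -/
theorem IsPerfectDyadicCZKernel.bmoNorm_le (hK : IsPerfectDyadicCZKernel K)
    (E : Finset (Fin m × Fin n)) {S : Finset (Fin m)} {T : Finset (Fin n)} {e : Fin m × Fin n}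
    (hS : ∀ i ∈ S, i = e.1) (hT : ∀ j ∈ T, j = e.2) (hST : e.1 ∈ S ∨ e.2 ∈ T) :
    bmoNorm (coefficient K S T) ≤ dyadicBMO (adjointOp E K e fun _ _ => 1) := by
  set f := adjointOp E K e fun _ _ => 1
  have hf : Integrable f := hK.integrable_adjointOp_one E e
  refine iSup_mono fun Q₀ => ENNReal.rpow_le_rpow (mul_le_mul_right ?_ _) (by norm_num)
  set c := (Q₀.area : ℂ)⁻¹ * ∫ w in Q₀.toSet, f w
  by_cases htop : ∫⁻ z in Q₀.toSet, ‖f z - c‖ₑ ^ 2 = ∞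
  · rw [htop]
    exact le_top
  have hg : MemLp (fun z => f z - c) 2 (volume.restrict Q₀.toSet) := by
    refine ⟨hf.1.restrict.sub aestronglyMeasurable_const, ?_⟩
    rw [eLpNorm_eq_lintegral_rpow_enorm_toReal two_ne_zero ENNReal.ofNat_ne_top]
    refine ENNReal.rpow_lt_top_of_nonneg (by norm_num) ?_
    simpa using htop
  rw [ENNReal.tsum_eq_iSup_sum]
  refine iSup_le fun s => ?_
  refine le_trans (le_of_eq ?_) (sum_norm_integral_sq_le (c := e.1 ∈ S) (c' := e.2 ∈ T) hST Q₀ hg s)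
  refine Finset.sum_congr rfl fun Q _ => ?_
  have hb := bddMeasurable_squareHaar (e.1 ∈ S) (e.2 ∈ T) Q.1
  have hi1 : Integrable fun z => (squareHaar (e.1 ∈ S) (e.2 ∈ T) Q.1 z : ℂ) * f z := by
    simpa [mul_comm] using integrable_mul_bddMeasurable hf hb
  have hset : ∀ g : ℝ × ℝ → ℂ,
      ∫ z in Q₀.toSet, (squareHaar (e.1 ∈ S) (e.2 ∈ T) Q.1 z : ℂ) * g z
        = ∫ z, (squareHaar (e.1 ∈ S) (e.2 ∈ T) Q.1 z : ℂ) * g z := by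
    intro g
    refine setIntegral_eq_integral_of_forall_compl_eq_zero fun z hz => ?_
    rw [squareHaar_of_notMem fun h => hz (Q.2 h), Complex.ofReal_zero, zero_mul]
  have hi2 : Integrable fun z => (squareHaar (e.1 ∈ S) (e.2 ∈ T) Q.1 z : ℂ) * c := by
    refine Integrable.mul_const (Integrable.ofReal ?_) c
    exact ((integrable_haarOrChar _ _ _).mul_prod (integrable_haarOrChar _ _ _))
  have hval : ∫ z in Q₀.toSet, (squareHaar (e.1 ∈ S) (e.2 ∈ T) Q.1 z : ℂ) * (f z - c)
      = Q.1.area * coefficient K S T Q.1 := by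
    rw [hset, hK.area_mul_coefficient E hS hT hST]
    simp_rw [mul_sub]
    rw [integral_sub hi1 hi2, integral_mul_const, integral_complex_ofReal,
      integral_squareHaar hST]
    simp [f]
  have ha := Q.1.area_pos
  rw [hval, ← ofReal_norm, ← ofReal_norm, norm_mul, Complex.norm_real, Real.norm_eq_abs,
    abs_of_pos ha, ← ENNReal.ofReal_pow (norm_nonneg _), ← ENNReal.ofReal_pow (by positivity),
    ← ENNReal.ofReal_mul ha.le, ← ENNReal.ofReal_mul (by positivity)]
  congr 1
  field_simp

end Kernel

end

end EntangledParaproduct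

theorem proposition3p2 (m n : ℕ) (hm : 0 < m) (hn : 0 < n)
    (E : Finset (Fin m × Fin n)) (hE : NoIsolatedVertices E)
    (S : Finset (Fin m)) (T : Finset (Fin n)) (hST : S.Nonempty ∨ T.Nonempty)
    (hnc : IsNonCancellative E S T) :
    (∀ B : ℝ, ∃ C : ℝ, ∀ K : (Fin m → ℝ) × (Fin n → ℝ) → ℂ, IsPerfectDyadicCZKernel K →
      (∀ e ∈ E, dyadicBMO (adjointOp E K e (fun _ _ => 1)) ≤ ENNReal.ofReal B) →
        bmoNorm (coefficient K S T) ≤ ENNReal.ofReal C) ∧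
    (∃ C : ℝ, ∀ K : (Fin m → ℝ) × (Fin n → ℝ) → ℂ, IsPerfectDyadicCZKernel K →
      ∀ (𝒯 : FiniteConvexTree) (F : Fin m × Fin n → ℝ × ℝ → ℝ),
        (∀ e ∈ E, IsAdmissible (F e)) →
          ENNReal.ofReal (localizedForm E S T (coefficient K S T) 𝒯 F) ≤
            ENNReal.ofReal C * bmoNorm (coefficient K S T) * ENNReal.ofReal 𝒯.top.area *
              ∏ e ∈ E, maxPowerMean (threshold E e) (F e) 𝒯) := by
  refine ⟨fun B => ⟨B, fun K hK hB => ?_⟩, ?_⟩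
  · obtain ⟨e, he, hS, hT, hST'⟩ := hnc.exists_edge hST
    exact (hK.bmoNorm_le E hS hT hST').trans (hB e he)
  · obtain ⟨C, hC⟩ := exists_localizedForm_le E S T hST hnc
    exact ⟨C, fun K _ 𝒯 F hF => hC _ 𝒯 F hF⟩
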